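/- **Setting.** A lattice $\mathcal L\subset\mathbb R^n$ is the set of integer combinations of $n$ linearly independent vectors; $\mathcal L^*$ is its dual lattice. Write $\rho_s(x)=e^{-\pi\|x\|^2/s^2}$, and let $D_{\mathcal L,s}$ be the distribution on $\mathcal L$ that gives $y$ probability $\rho_s(y)/\sum_{x\in\mathcal L}\rho_s(x)$. The smoothing parameter $\eta(\mathcal L)$ is the unique $s>0$ with $\sum_{w\in\mathcal L^*}\rho_{1/s}(w)=3/2$. Solving $d$-GDD on $\mathcal L$ means to find, for a given target $t\in\mathbb R^n$, a vector $z\in\mathcal L$ with $\|z-t\|\le d$. In GDD with preprocessing, the query algorithm also receives preprocessing data that depend on $\mathcal L$ but not on $t$, and only its running time counts. **Algorithm.** The preprocessing is a list $y_1,\dots,y_N\in\mathcal L$, stored together with an LLL-reduced basis of $\mathcal L$ (parameter $3/4$). On input $t$, compute with Babai's nearest plane algorithm a vector $t_0\in\mathcal L+t$ with $\|t_0\|\le 2^n\eta(\mathcal L)$. Then, for $j=0,1,\dots$, find an index $i$ and an integer $k$ with $\|t_j-ky_i\|^2\le(1-1/n^2)\|t_j\|^2$ and set $t_{j+1}=t_j-ky_i$.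 Stop when no such $(i,k)$ exists or $j=100n^3$, and output $t-t_j$. **Theorem 3.1.** There is a universal constant $C$ such that the following holds for all $n\ge 40$, all $\alpha$ with $\frac{2}{\log_2 n}\le\alpha\le\frac12$ and all lattices $\mathcal L\subset\mathbb R^n$. Let $N_\alpha=n^2e^{(n^{1/2-\alpha}+4)^2}$, $N=\lceil N_\alpha\rceil$ and $d=n^{1/2+\alpha}\eta(\mathcal L)$. 1. $N\le 2^{C(n^{1-2\alpha}+\log_2 n)}$. 2. $\mathcal L$ has an LLL-reduced basis. For every LLL-reduced basis of $\mathcal L$, all $y_1,\dots,y_N\in\mathcal L$ and every $t\in\mathbb R^n$, the query algorithm, which searches the list in order and takes for each $y_i$ an integer $k$ minimizing $\|t_j-ky_i\|$, correctly executes the procedure above (in particular $\|t_0\|\le2^n\eta(\mathcal L)$), and it runs in time at most $C\,n^C\cdot N_\alpha$, where arithmetic operations, comparisons and roundings of real numbers, memory accesses and loop steps have unit cost. 3. If $y_1,\dots,y_N$ are independent samples from $D_{\mathcal L,\eta(\mathcal L)}$, then with probability at least $1-2^{-n}$ the following holds simultaneously for all targets $t\in\mathbb R^n$: whatever $t_0\in\mathcal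 L+t$ with $\|t_0\|\le2^n\eta(\mathcal L)$ and whatever admissible pairs $(i,k)$ are chosen, the output $z$ satisfies $z\in\mathcal L$ and $\|z-t\|\le d$. In particular, for every LLL-reduced basis of $\mathcal L$, the query algorithm of 2 solves $d$-GDD on $\mathcal L$ for every target. -/

import Mathlib

open MeasureTheory
open scoped ENNReal

noncomputable section

namespace GDD

/-- The ambient space `ℝⁿ` with the Euclidean norm. -/
abbrev E (n : ℕ) : Type := EuclideanSpace ℝ (Fin n)

/-! ### Discrete Gaussians and the smoothing parameter -/

/-- The Gaussian mass `ρ_s(x) = exp(-π ‖x‖² / s²)` of a vector. -/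
def rho {n : ℕ} (s : ℝ) (x : E n) : ℝ := Real.exp (-Real.pi * ‖x‖ ^ 2 / s ^ 2)

/-- The Gaussian mass `ρ_s(L) = ∑_{y ∈ L} ρ_s(y)` of a lattice. -/
def rhoLattice {n : ℕ} (s : ℝ) (L : Submodule ℤ (E n)) : ℝ := ∑' y : L, rho s (y : E n)

/-- The dual lattice: all `w` such that `⟪w, y⟫ ∈ ℤ` for every `y ∈ L`. -/
def dualLattice {n : ℕ} (L : Submodule ℤ (E n)) : Submodule ℤ (E n) :=
  LinearMap.BilinForm.dualSubmodule (innerₗ (E n)) L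

theorem mem_dualLattice {n : ℕ} (L : Submodule ℤ (E n)) (w : E n) :
    w ∈ dualLattice L ↔ ∀ y ∈ L, ∃ z : ℤ, inner ℝ w y = (z : ℝ) := by
  simp only [dualLattice, LinearMap.BilinForm.mem_dualSubmodule, Submodule.mem_one]
  refine forall₂_congr fun y _ => exists_congr fun z => ?_
  simp [eq_comm]

/-- The smoothing parameter `η(L)`, the unique `s > 0` with `ρ_{1/s}(L*) = 3/2`. For a lattice of
positive dimension the set below has exactly one element (`s ↦ ρ_{1/s}(L*)` is continuous and
strictly decreasing from `∞` to `1`), so its infimum is that element. -/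
def eta {n : ℕ} (L : Submodule ℤ (E n)) : ℝ :=
  sInf {s : ℝ | 0 < s ∧ rhoLattice (1 / s) (dualLattice L) = 3 / 2}

/-- The discrete Gaussian distribution `D_{L,s}`: each `y ∈ L` has mass `ρ_s(y) / ρ_s(L)`. -/
def discreteGaussian {n : ℕ} (L : Submodule ℤ (E n)) (s : ℝ) : Measure L :=
  Measure.sum fun y : L => ENNReal.ofReal (rho s (y : E n) / rhoLattice s L) • Measure.dirac y

/-! ### The number of samples -/

/-- `N_α = n² · exp((n^{1/2-α} + 4)²)`. -/
def nAlpha (n : ℕ) (α : ℝ) : ℝ :=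
  (n : ℝ) ^ 2 * Real.exp (((n : ℝ) ^ (1 / 2 - α) + 4) ^ 2)

/-- The number of samples: `N_α`, rounded up to a natural number. -/
def sampleCount (n : ℕ) (α : ℝ) : ℕ := ⌈nAlpha n α⌉₊

/-! ### Guaranteed distance decoding and the iterative reduction, as a nondeterministic procedure -/

/-- `A` solves `d`-GDD on the lattice `L`: for every target it returns a lattice vector within
distance `d` of the target. -/
def SolvesGDD {n : ℕ} (L : Submodule ℤ (E n)) (d : ℝ) (A : E n → E n) : Prop :=
  ∀ t : E n, A t ∈ L ∧ ‖A t - t‖ ≤ d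

/-- One reduction step: `u = t - k yᵢ` for some index `i` and some integer `k`, with
`‖u‖² ≤ (1 - 1/n²) ‖t‖²`. -/
def IsStep {n N : ℕ} (y : Fin N → E n) (t u : E n) : Prop :=
  ∃ (i : Fin N) (k : ℤ), u = t - (k : ℝ) • y i ∧ ‖u‖ ^ 2 ≤ (1 - 1 / (n : ℝ) ^ 2) * ‖t‖ ^ 2

/-- `z` is a possible output of the iterative reduction with list `y` on target `t`: start from some
`τ₀ ∈ L + t` with `‖τ₀‖ ≤ 2ⁿ η(L)`, perform reduction steps (with arbitrary admissible choices
of `i` and `k`) until none is possible or `100 n³` of them have been made, and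
return `t - τⱼ`. -/
def IsOutput {n N : ℕ} (L : Submodule ℤ (E n)) (y : Fin N → E n) (t z : E n) : Prop :=
  ∃ (j : ℕ) (τ : ℕ → E n),
    τ 0 - t ∈ L ∧ ‖τ 0‖ ≤ 2 ^ n * eta L ∧
    (∀ m < j, IsStep y (τ m) (τ (m + 1))) ∧
    (j = 100 * n ^ 3 ∨ (j < 100 * n ^ 3 ∧ ∀ u, ¬ IsStep y (τ j) u)) ∧
    z = t - τ j

/-! ### LLL-reduced bases -/

/-- The basis is LLL-reduced with parameter `3/4`: it is size-reduced and satisfies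
the Lovász condition. -/
def IsLLLReduced {n : ℕ} {L : Submodule ℤ (E n)} (b : Module.Basis (Fin n) ℤ L) : Prop :=
  let v : Fin n → E n := fun i => (b i : E n)
  let g : Fin n → E n := InnerProductSpace.gramSchmidt ℝ v
  let μ : Fin n → Fin n → ℝ := fun i j => inner ℝ (v i) (g j) / ‖g j‖ ^ 2
  (∀ i j : Fin n, j < i → |μ i j| ≤ 1 / 2) ∧
  (∀ i j : Fin n, (j : ℕ) = i + 1 →
    3 / 4 * ‖g i‖ ^ 2 ≤ ‖g j‖ ^ 2 + μ j i ^ 2 * ‖g i‖ ^ 2)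

/-! ### Step counting

The cost model is a random access machine over the reals with unit cost: an arithmetic operation, a
comparison, a rounding to the nearest integer, a memory access to one coordinate
and the bookkeeping of one loop iteration take one step each. The programs below touch real numbers
only through these primitives. -/

/-- A computation with its result and the number of steps it takes. -/
structure Timed (A : Type) where
  /-- the result -/
  val : A
  /-- the number of steps -/
  steps : ℕ

namespace Timed

instance : Monad Timed where
  pure a := ⟨a, 0⟩
  bind x f := ⟨(f x.val).val, x.steps + (f x.val).steps⟩

/-- Bookkeeping of one loop iteration. -/
def tick : Timed Unit := ⟨(), 1⟩

/-- Addition. -/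
def add (a b : ℝ) : Timed ℝ := ⟨a + b, 1⟩

/-- Subtraction. -/
def sub (a b : ℝ) : Timed ℝ := ⟨a - b, 1⟩

/-- Multiplication. -/
def mul (a b : ℝ) : Timed ℝ := ⟨a * b, 1⟩

/-- Division; only applied with a nonzero denominator below. -/
def div (a b : ℝ) : Timed ℝ := ⟨a / b, 1⟩

/-- Comparison. -/
def le (a b : ℝ) : Timed Bool := ⟨decide (a ≤ b), 1⟩

/-- Rounding to a nearest integer. -/
def nearest (a : ℝ) : Timed ℝ := ⟨(round a : ℝ), 1⟩

/-- Reading a coordinate of a stored vector. -/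
def read {n : ℕ} (v : E n) (i : Fin n) : Timed ℝ := ⟨v i, 1⟩

/-- A loop over the coordinates that computes the terms `f i` and adds them up: besides the terms,
one addition and one loop step per coordinate. -/
def sum {n : ℕ} (f : Fin n → Timed ℝ) : Timed ℝ :=
  ⟨∑ i, (f i).val, ∑ i, ((f i).steps + 2)⟩

/-- A loop over the coordinates that computes the entries `f i` and stores them as a vector: besides
the entries, one memory access and one loop step per coordinate. -/
def tabulate {n : ℕ} (f : Fin n → Timed ℝ) : Timed (E n) :=
  ⟨WithLp.toLp 2 fun i => (f i).val, ∑ i, ((f i).steps + 2)⟩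

end Timed

/-! ### The query algorithm -/

/-- The inner product of two vectors. -/
def dot {n : ℕ} (u v : E n) : Timed ℝ :=
  Timed.sum fun i => do
    let a ← Timed.read u i
    let b ← Timed.read v i
    Timed.mul a b

/-- The coefficient `⟪t, y⟫ / ⟪y, y⟫`, or `0` when `y = 0`. -/
def coeff {n : ℕ} (t y : E n) : Timed ℝ := do
  let p ← dot t y
  let q ← dot y y
  if ← Timed.le q 0 then
    pure 0
  else
    Timed.div p q

/-- The vector `t - c • y`. -/
def subMul {n : ℕ} (t : E n) (c : ℝ) (y : E n) : Timed (E n) :=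
  Timed.tabulate fun i => do
    let a ← Timed.read t i
    let b ← Timed.read y i
    let p ← Timed.mul c b
    Timed.sub a p

/-- Subtract from `v` the projections of `b` onto the Gram-Schmidt vectors (the second components)
in the list. -/
def orthogonalize {n : ℕ} (b : E n) : List (E n × E n) → E n → Timed (E n)
  | [], v => pure v
  | p :: l, v => do
    Timed.tick
    let c ← coeff b p.2
    let w ← subMul v c p.2
    orthogonalize b l w

/-- Gram-Schmidt orthogonalization: pair every basis vector with its Gram-Schmidt vector, the last
one first. -/
def gramSchmidtPairs {n : ℕ} : List (E n) → List (E n × E n) → Timed (List (E n × E n))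
  | [], acc => pure acc
  | b :: bs, acc => do
    Timed.tick
    let g ← orthogonalize b acc b
    gramSchmidtPairs bs ((b, g) :: acc)

/-- The nearest plane loop: for each pair `(b, g)` replace `t` by `t - k b`, where `k` is the integer
nearest to `⟪t, g⟫ / ⟪g, g⟫`. -/
def nearestPlane {n : ℕ} : List (E n × E n) → E n → Timed (E n)
  | [], t => pure t
  | p :: l, t => do
    Timed.tick
    let x ← coeff t p.2
    let k ← Timed.nearest x
    let u ← subMul t k p.1
    nearestPlane l u

/-- Babai's nearest plane algorithm: from a basis and a target `t`, a short vector of `L + t`. -/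
def babai {n : ℕ} (bs : List (E n)) (t : E n) : Timed (E n) := do
  let l ← gramSchmidtPairs bs []
  nearestPlane l t

/-- Search the list for the first `y` that reduces `t`, where `k` is the integer for which `t - k y`
is shortest; return the reduced vector if there is one. -/
def search {n : ℕ} (t : E n) : List (E n) → Timed (Option (E n))
  | [] => pure none
  | y :: l => do
    Timed.tick
    let x ← coeff t y
    let k ← Timed.nearest x
    let u ← subMul t k y
    let a ← dot u u
    let c ← dot t t
    let m ← Timed.mul (n : ℝ) (n : ℝ)
    let r ← Timed.div 1 m
    let f ← Timed.sub 1 r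
    let e ← Timed.mul f c
    if ← Timed.le a e then
      pure (some u)
    else
      search t l

/-- Reduce `t` repeatedly, until no reduction is found or the given number of rounds is used up. -/
def reduce {n : ℕ} (ys : List (E n)) : ℕ → E n → Timed (E n)
  | 0, t => pure t
  | j + 1, t => do
    Timed.tick
    match ← search t ys with
    | none => pure t
    | some u => reduce ys j u

/-- The query algorithm: from the basis `bs`, the sample list `ys` and the target `t`, compute a lattice
vector near `t`. -/
def query {n : ℕ} (bs ys : List (E n)) (t : E n) : Timed (E n) := do
  let t₀ ← babai bs t
  let u ← reduce ys (100 * n ^ 3) t₀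
  subMul t 1 u

/-- The query algorithm for a basis of `L` and a tuple of lattice vectors. -/
def queryLattice {n N : ℕ} {L : Submodule ℤ (E n)} (b : Module.Basis (Fin n) ℤ L)
    (y : Fin N → L) (t : E n) : Timed (E n) :=
  query (List.ofFn fun i => (b i : E n)) (List.ofFn fun i => (y i : E n)) t

end GDD

end

namespace GDD

open Filter Topology

/-! ### Gaussian sums over shifted lattices -/

/-- The Gaussian mass of the shifted lattice `L - v`. -/
noncomputable def shiftedMass {n : ℕ} (s : ℝ) (L : Submodule ℤ (E n)) (v : E n) : ℝ :=
  ∑' y : L, rho s ((y : E n) - v)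

section Rho

variable {n : ℕ}

theorem rho_pos (s : ℝ) (x : E n) : 0 < rho s x := Real.exp_pos _

@[simp]
theorem rho_zero (s : ℝ) : rho s (0 : E n) = 1 := by simp [rho]

@[simp]
theorem rho_neg (s : ℝ) (x : E n) : rho s (-x) = rho s x := by simp [rho]

theorem continuous_rho (s : ℝ) : Continuous (rho (n := n) s) := by
  unfold rho; fun_prop

theorem rho_mono_scale {s r : ℝ} (hs : 0 < s) (hr : s ≤ r) (x : E n) : rho s x ≤ rho r x := by
  unfold rho
  rw [neg_mul, neg_div, neg_div]
  gcongr

theorem rho_sub_le {s : ℝ} (y v : E n) :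
    rho s (y - v) ≤ Real.exp (Real.pi * ‖v‖ ^ 2 / s ^ 2) * rho (√2 * s) y := by
  unfold rho
  rw [← Real.exp_add]
  apply Real.exp_le_exp.2
  rcases eq_or_ne s 0 with rfl | hs
  · simp
  have h1 : ‖y‖ ≤ ‖y - v‖ + ‖v‖ := by simpa using norm_add_le (y - v) v
  have h2 : ‖y‖ ^ 2 ≤ 2 * ‖y - v‖ ^ 2 + 2 * ‖v‖ ^ 2 := by
    nlinarith [sq_nonneg (‖y - v‖ - ‖v‖), norm_nonneg y]
  have hs' : 0 < s ^ 2 := by positivity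
  rw [mul_pow, Real.sq_sqrt (by norm_num), div_add_div _ _ hs'.ne' (by positivity),
    div_le_div_iff₀ hs' (by positivity)]
  have : 0 ≤ Real.pi * (2 * ‖y - v‖ ^ 2 + 2 * ‖v‖ ^ 2 - ‖y‖ ^ 2) :=
    mul_nonneg Real.pi_pos.le (by linarith)
  nlinarith [mul_nonneg this (sq_nonneg (s ^ 2))]

theorem rho_tilt {s : ℝ} (hs : s ≠ 0) (x w : E n) :
    rho s x * Real.exp (2 * Real.pi * inner ℝ w x / s ^ 2) =
      Real.exp (Real.pi * ‖w‖ ^ 2 / s ^ 2) * rho s (x - w) := by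
  unfold rho
  rw [← Real.exp_add, ← Real.exp_add, @norm_sub_sq_real, real_inner_comm]
  congr 1
  field_simp
  ring

variable (L : Submodule ℤ (E n))

theorem rhoLattice_eq_shiftedMass (s : ℝ) : rhoLattice s L = shiftedMass s L 0 := by
  simp [rhoLattice, shiftedMass]

variable [DiscreteTopology L]

theorem summable_rho {s : ℝ} (hs : s ≠ 0) : Summable fun y : L => rho s (y : E n) := by
  set k := Module.finrank ℤ L + 1
  have h := ZLattice.summable_norm_pow_inv (L := L) (2 * k) (by omega)
  refine Summable.of_norm_bounded_eventually
    (h.mul_left (k.factorial * (s ^ 2 / Real.pi) ^ k)) ?_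
  have hfin : ({0} : Set L).Finite := Set.finite_singleton 0
  refine hfin.subset fun y hy => ?_
  by_contra hy0
  apply hy
  have hpos : 0 < ‖(y : E n)‖ := by
    rw [norm_pos_iff]; simpa using hy0
  have hpi := Real.pi_pos
  change ‖rho s (y : E n)‖ ≤ _
  rw [Real.norm_of_nonneg (rho_pos _ _).le]
  unfold rho
  have h1 := Real.pow_div_factorial_le_exp (Real.pi * ‖(y : E n)‖ ^ 2 / s ^ 2) (by positivity) k
  rw [neg_mul, neg_div, Real.exp_neg]
  calc _ ≤ ((Real.pi * ‖(y : E n)‖ ^ 2 / s ^ 2) ^ k / k.factorial)⁻¹ := by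
        gcongr
    _ = _ := by
      simp only [Submodule.coe_norm, div_pow, mul_pow, inv_pow, pow_mul]
      field_simp

theorem summable_rho_sub {s : ℝ} (hs : s ≠ 0) (v : E n) :
    Summable fun y : L => rho s ((y : E n) - v) :=
  Summable.of_nonneg_of_le (fun _ => (rho_pos _ _).le) (fun y => rho_sub_le _ v)
    ((summable_rho L (s := √2 * s) (by positivity)).mul_left _)

theorem shiftedMass_pos {s : ℝ} (hs : s ≠ 0) (v : E n) : 0 < shiftedMass s L v :=
  (summable_rho_sub L hs v).tsum_pos (fun _ => (rho_pos _ _).le) 0 (rho_pos _ _)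

theorem continuous_shiftedMass {s : ℝ} (hs : s ≠ 0) : Continuous (shiftedMass s L) := by
  rw [continuous_iff_continuousAt]
  intro v
  have hc : ContinuousOn (shiftedMass s L) (Metric.ball v 1) := by
    refine continuousOn_tsum (u := fun y : L =>
      Real.exp (Real.pi * (‖v‖ + 1) ^ 2 / s ^ 2) * rho (√2 * s) (y : E n)) (fun y => ?_)
      ((summable_rho L (by positivity)).mul_left _) fun y x hx => ?_
    · exact ((continuous_rho s).comp (continuous_const.sub continuous_id)).continuousOn
    · rw [Real.norm_of_nonneg (rho_pos _ _).le]
      refine (rho_sub_le _ x).trans ?_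
      have : ‖x‖ ≤ ‖v‖ + 1 := by
        have := norm_le_norm_add_norm_sub' x v
        have h2 := mem_ball_iff_norm.1 hx
        linarith
      gcongr
      exact (rho_pos _ _).le
  exact hc.continuousAt (Metric.ball_mem_nhds v one_pos)

end Rho

/-! ### The dual lattice -/

section Dual

variable {n : ℕ} (L : Submodule ℤ (E n)) [DiscreteTopology L] [IsZLattice ℝ L]

theorem finrank_lattice : Module.finrank ℤ L = n := by
  rw [ZLattice.rank ℝ L]; simp

/-- A basis of the lattice, indexed by the coordinates. -/
noncomputable def latticeBasis : Module.Basis (Fin n) ℤ L :=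
  (Module.Free.chooseBasis ℤ L).reindex (Fintype.equivOfCardEq
    (by rw [← Module.finrank_eq_card_chooseBasisIndex, finrank_lattice, Fintype.card_fin]))

theorem innerForm_nondegenerate : (innerₗ (E n)).Nondegenerate := by
  constructor
  · intro x hx
    simpa using hx x
  · intro x hx
    simpa using hx x

variable {L}

theorem dualLattice_eq_span (b : Module.Basis (Fin n) ℤ L) :
    dualLattice L = Submodule.span ℤ (Set.range
      (LinearMap.BilinForm.dualBasis (innerₗ (E n)) innerForm_nondegenerate
        (b.ofZLatticeBasis ℝ))) := by
  rw [← LinearMap.BilinForm.dualSubmodule_span_of_basis, b.ofZLatticeBasis_span ℝ, dualLattice]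

variable (L) in
instance dualLattice_discrete : DiscreteTopology (dualLattice L) := by
  rw [dualLattice_eq_span (latticeBasis L)]
  infer_instance

variable (L) in
instance dualLattice_isZLattice : IsZLattice ℝ (dualLattice L) := by
  constructor
  rw [dualLattice_eq_span (latticeBasis L)]
  exact ZSpan.span_top _

theorem inner_dualBasis (b : Module.Basis (Fin n) ℤ L) (i j : Fin n) :
    inner ℝ (LinearMap.BilinForm.dualBasis (innerₗ (E n)) innerForm_nondegenerate
        (b.ofZLatticeBasis ℝ) i) (b j : E n) = if j = i then (1 : ℝ) else 0 := by
  have := LinearMap.BilinForm.apply_dualBasis_left innerForm_nondegenerate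
    (b.ofZLatticeBasis ℝ) i j
  simpa using this

theorem ext_inner_basis (b : Module.Basis (Fin n) ℤ L) {x y : E n}
    (h : ∀ i, inner ℝ x (b i : E n) = inner ℝ y (b i : E n)) : x = y := by
  refine ext_inner_right ℝ fun v => ?_
  have h' : innerₗ (E n) x = innerₗ (E n) y := by
    refine (b.ofZLatticeBasis ℝ).ext fun i => ?_
    simpa using h i
  exact LinearMap.congr_fun h' v

theorem exists_equiv_dualLattice (b : Module.Basis (Fin n) ℤ L) :
    ∃ e : (Fin n → ℤ) ≃ dualLattice L,
      ∀ k i, inner ℝ (e k : E n) (b i : E n) = (k i : ℝ) := by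
  set D := LinearMap.BilinForm.dualBasis (innerₗ (E n)) innerForm_nondegenerate
        (b.ofZLatticeBasis ℝ) with hD
  have hin : ∀ (k : Fin n → ℤ) i, inner ℝ (∑ j, k j • D j) (b i : E n) = (k i : ℝ) := by
    intro k i
    simp_rw [← Int.cast_smul_eq_zsmul ℝ, sum_inner, inner_smul_left, hD, inner_dualBasis]
    simp
  have hmem : ∀ k : Fin n → ℤ, ∑ j, k j • D j ∈ dualLattice L := by
    intro k
    rw [dualLattice_eq_span b]
    exact Submodule.sum_mem _ fun j _ =>
      Submodule.smul_mem _ _ (Submodule.subset_span ⟨j, rfl⟩)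
  refine ⟨Equiv.ofBijective (fun k => ⟨∑ j, k j • D j, hmem k⟩) ⟨?_, ?_⟩, fun k i => hin k i⟩
  · intro k k' h
    have h' : ∑ j, k j • D j = ∑ j, k' j • D j := congrArg Subtype.val h
    ext i
    have := hin k i
    rw [h', hin] at this
    exact_mod_cast this.symm
  · rintro ⟨w, hw⟩
    choose z hz using fun i => (mem_dualLattice L w).1 hw (b i : E n) (b i).2
    refine ⟨z, Subtype.ext (ext_inner_basis b fun i => ?_)⟩
    rw [hz]; exact hin z i

end Dual

end GDD

namespace GDD

open Filter Topology

/-! ### Poisson summation for Gaussians -/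

section Poisson

variable {ι : Type*}

/-- The unit cube with lower corner `a`. -/
def unitCube (a : ι → ℝ) : Set (ι → ℝ) := {x | ∀ i, x i ∈ Set.Ioc (a i) (a i + 1)}

theorem measurableSet_unitCube [Countable ι] (a : ι → ℝ) : MeasurableSet (unitCube a) :=
  MeasurableSet.univ_pi' fun _ => measurableSet_Ioc

theorem iUnion_unitCube : ⋃ m : ι → ℤ, unitCube (fun i => (m i : ℝ)) = Set.univ := by
  refine Set.eq_univ_of_forall fun x => Set.mem_iUnion.2 ⟨fun i => ⌈x i⌉ - 1, fun i => ?_⟩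
  have h1 := Int.ceil_lt_add_one (x i)
  have h2 := Int.le_ceil (x i)
  push_cast
  exact ⟨by linarith, by linarith⟩

theorem pairwise_disjoint_unitCube :
    Pairwise (Function.onFun Disjoint fun m : ι → ℤ => unitCube (fun i => (m i : ℝ))) := by
  intro m m' hne
  refine Set.disjoint_left.2 fun x hx hx' => hne (funext fun i => ?_)
  have h1 := hx i
  have h2 := hx' i
  have h3 : ((m i : ℤ) : ℝ) < m' i + 1 := h1.1.trans_le h2.2
  have h4 : ((m' i : ℤ) : ℝ) < m i + 1 := h2.1.trans_le h1.2
  norm_cast at h3 h4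
  omega

/-- The projection of `ℝⁿ` onto the torus. -/
noncomputable def toTorus (x : ι → ℝ) : UnitAddTorus ι := fun i => (x i : UnitAddCircle)

theorem isOpenQuotientMap_toTorus : IsOpenQuotientMap (toTorus (ι := ι)) :=
  IsOpenQuotientMap.piMap fun _ => QuotientAddGroup.isOpenQuotientMap_mk

theorem toTorus_eq_iff {x y : ι → ℝ} (h : toTorus x = toTorus y) :
    ∃ m : ι → ℤ, y = x + fun i => (m i : ℝ) := by
  have hm : ∀ i, ∃ m : ℤ, m • (1 : ℝ) = y i - x i := fun i => by
    rw [← AddCircle.coe_eq_zero_iff, AddCircle.coe_sub, sub_eq_zero]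
    exact (congrFun h i).symm
  choose m hm using hm
  refine ⟨m, funext fun i => ?_⟩
  have := hm i
  simp at this ⊢
  linarith

variable [Fintype ι]

theorem setIntegral_unitCube {F : Type*} [NormedAddCommGroup F] [NormedSpace ℝ F]
    (h : (ι → ℝ) → F) (a : ι → ℝ) :
    ∫ x in unitCube a, h x = ∫ x in unitCube 0, h (x + a) := by
  have h1 := (measurePreserving_add_right (volume : Measure (ι → ℝ)) a).setIntegral_preimage_emb
    (MeasurableEquiv.addRight a).measurableEmbedding h (unitCube a)
  rw [← h1]
  congr 2
  ext x
  simp only [unitCube, Set.mem_preimage, Set.mem_ofPred_eq, Pi.add_apply, Set.mem_Ioc, Pi.zero_apply]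
  refine forall_congr' fun i => ?_
  constructor <;> rintro ⟨_, _⟩ <;> constructor <;> linarith

/-- Unfolding: integrating a periodization over a unit cube integrates over the whole space. -/
theorem setIntegral_tsum_unitCube {h : (ι → ℝ) → ℂ} (hi : Integrable h) :
    ∫ x in unitCube 0, ∑' m : ι → ℤ, h (x + fun i => (m i : ℝ)) = ∫ x, h x := by
  have key : HasSum (fun m : ι → ℤ => ∫ x in unitCube 0, h (x + fun i => (m i : ℝ)))
      (∫ x in unitCube 0, ∑' m : ι → ℤ, h (x + fun i => (m i : ℝ))) := by
    refine hasSum_integral_of_summable_integral_norm (fun m => ?_) ?_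
    · exact (hi.comp_add_right _).integrableOn
    · have := hasSum_integral_iUnion (f := fun x => ‖h x‖)
        (fun m : ι → ℤ => measurableSet_unitCube fun i => (m i : ℝ)) pairwise_disjoint_unitCube
        hi.norm.integrableOn
      refine this.summable.congr fun m => ?_
      rw [setIntegral_unitCube]
  have key2 := hasSum_integral_iUnion (f := h)
    (fun m : ι → ℤ => measurableSet_unitCube fun i => (m i : ℝ)) pairwise_disjoint_unitCube
    hi.integrableOn
  rw [iUnion_unitCube, setIntegral_univ] at key2
  rw [funext fun m : ι → ℤ => setIntegral_unitCube h fun i => (m i : ℝ)] at key2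
  exact key.unique key2

theorem mFourier_toTorus (k : ι → ℤ) (x : ι → ℝ) :
    UnitAddTorus.mFourier k (toTorus x) =
      Complex.exp (2 * Real.pi * Complex.I * ((∑ i, k i * x i : ℝ) : ℂ)) := by
  simp only [UnitAddTorus.mFourier, ContinuousMap.coe_mk, toTorus, fourier_coe_apply]
  rw [← Complex.exp_sum]
  congr 1
  push_cast
  rw [Finset.mul_sum]
  refine Finset.sum_congr rfl fun i _ => ?_
  simp; ring

/-- Poisson summation on `ℝⁿ`, for a function with a continuous periodization. -/
theorem hasSum_poisson {f : (ι → ℝ) → ℝ} (hi : Integrable f)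
    (hc : Continuous fun x : ι → ℝ => ∑' m : ι → ℤ, f (x + fun i => (m i : ℝ)))
    (hs : Summable fun k : ι → ℤ => ∫ x, UnitAddTorus.mFourier (-k) (toTorus x) * (f x : ℂ))
    (x : ι → ℝ) :
    HasSum (fun k : ι → ℤ => (∫ x, UnitAddTorus.mFourier (-k) (toTorus x) * (f x : ℂ)) *
        UnitAddTorus.mFourier k (toTorus x))
      ((∑' m : ι → ℤ, f (x + fun i => (m i : ℝ)) : ℝ) : ℂ) := by
  set G : (ι → ℝ) → ℝ := fun x => ∑' m : ι → ℤ, f (x + fun i => (m i : ℝ)) with hG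
  have hper : ∀ x y, toTorus x = toTorus y → G x = G y := by
    intro x y hxy
    obtain ⟨m, rfl⟩ := toTorus_eq_iff hxy
    rw [hG]
    dsimp only
    rw [← (Equiv.addLeft m).tsum_eq]
    refine tsum_congr fun k => ?_
    congr 1
    ext i
    simp; ring
  let r : UnitAddTorus ι → (ι → ℝ) := Function.surjInv isOpenQuotientMap_toTorus.surjective
  have hr : ∀ x, G (r (toTorus x)) = G x := fun x =>
    hper _ _ (Function.surjInv_eq isOpenQuotientMap_toTorus.surjective _)
  have hcont : Continuous fun θ => ((G (r θ) : ℝ) : ℂ) := by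
    rw [← isOpenQuotientMap_toTorus.continuous_comp_iff]
    refine (Complex.continuous_ofReal.comp hc).congr fun x => ?_
    simp only [Function.comp_apply, hr]
  let g : C(UnitAddTorus ι, ℂ) := ⟨_, hcont⟩
  have hint : ∀ k, Integrable fun x => UnitAddTorus.mFourier (-k) (toTorus x) * (f x : ℂ) := by
    intro k
    refine hi.ofReal.bdd_mul (c := 1) ?_ ?_
    · exact ((UnitAddTorus.mFourier (-k)).continuous.comp
        isOpenQuotientMap_toTorus.continuous).aestronglyMeasurable
    · refine Eventually.of_forall fun x => ?_
      exact (ContinuousMap.norm_coe_le_norm _ _).trans UnitAddTorus.mFourier_norm.le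
  have hcoef : ∀ k, UnitAddTorus.mFourierCoeff g k =
      ∫ x, UnitAddTorus.mFourier (-k) (toTorus x) * (f x : ℂ) := by
    intro k
    rw [UnitAddTorus.mFourierCoeff_eq_integral g k 0, ← setIntegral_tsum_unitCube (hint k)]
    refine integral_congr_ae (Eventually.of_forall fun x => ?_)
    change UnitAddTorus.mFourier (-k) (toTorus x) * ((G (r (toTorus x)) : ℝ) : ℂ) = _
    dsimp only
    rw [hr, hG]
    dsimp only
    rw [Complex.ofReal_tsum, ← tsum_mul_left]
    refine tsum_congr fun m => ?_
    congr 2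
    funext i
    simp [toTorus]
  have := UnitAddTorus.hasSum_mFourier_series_apply_of_summable (f := g)
    (hs.congr fun k => (hcoef k).symm) (toTorus x)
  simp only [hcoef, smul_eq_mul] at this
  convert this using 1
  change _ = ((G (r (toTorus x)) : ℝ) : ℂ)
  rw [hr]

end Poisson

section LatticePoisson

variable {n : ℕ} (L : Submodule ℤ (E n)) [DiscreteTopology L] [IsZLattice ℝ L]

theorem integrable_rho {s : ℝ} (hs : 0 < s) : Integrable (rho (n := n) s) := by
  have hpi := Real.pi_pos
  have h := GaussianFourier.integrable_cexp_neg_mul_sq_norm_add (V := E n)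
    (b := ((Real.pi / s ^ 2 : ℝ) : ℂ)) (by rw [Complex.ofReal_re]; positivity) 0 0
  refine h.re.congr (Eventually.of_forall fun x => ?_)
  simp only [rho, zero_mul, add_zero]
  rw [show -((Real.pi / s ^ 2 : ℝ) : ℂ) * (‖x‖ : ℂ) ^ 2 =
    ((-Real.pi * ‖x‖ ^ 2 / s ^ 2 : ℝ) : ℂ) by push_cast; ring, ← Complex.ofReal_exp]
  rfl

theorem fourier_rho {s : ℝ} (hs : 0 < s) (w : E n) :
    ∫ y, Complex.exp (2 * Real.pi * Complex.I * (-inner ℝ w y : ℝ)) * (rho s y : ℂ) =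
      (s ^ n * rho (1 / s) w : ℝ) := by
  have hpi := Real.pi_pos
  have h := fourier_gaussian_innerProductSpace (V := E n)
    (b := ((Real.pi / s ^ 2 : ℝ) : ℂ)) (by rw [Complex.ofReal_re]; positivity) w
  rw [Real.fourier_eq'] at h
  have hl : ∀ y : E n, Complex.exp (2 * Real.pi * Complex.I * (-inner ℝ w y : ℝ)) * (rho s y : ℂ) =
    Complex.exp (((-2 * Real.pi * inner ℝ y w : ℝ) : ℂ) * Complex.I) •
      Complex.exp (-((Real.pi / s ^ 2 : ℝ) : ℂ) * (‖y‖ : ℂ) ^ 2) := by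
    intro y
    rw [rho, smul_eq_mul, real_inner_comm]
    push_cast
    congr 2 <;> ring
  simp_rw [hl]
  rw [h]
  have h1 : (Real.pi : ℂ) / ((Real.pi / s ^ 2 : ℝ) : ℂ) = ((s ^ 2 : ℝ) : ℂ) := by
    rw [← Complex.ofReal_div]
    congr 1
    field_simp
  have h2 : (((Module.finrank ℝ (E n) : ℕ) : ℂ) / 2) = (((n : ℝ) / 2 : ℝ) : ℂ) := by simp
  rw [h1, h2, ← Complex.ofReal_cpow (by positivity), ← Real.rpow_natCast_mul hs.le]
  rw [show ((2 : ℕ) : ℝ) * ((n : ℝ) / 2) = n by push_cast; ring, Real.rpow_natCast, rho]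
  rw [show -(Real.pi : ℂ) ^ 2 * (‖w‖ : ℂ) ^ 2 / ((Real.pi / s ^ 2 : ℝ) : ℂ) =
    ((-Real.pi * ‖w‖ ^ 2 / (1 / s) ^ 2 : ℝ) : ℂ) by
      have : (Real.pi : ℂ) ≠ 0 := by exact_mod_cast hpi.ne'
      have : (s : ℂ) ≠ 0 := by exact_mod_cast hs.ne'
      push_cast; field_simp, ← Complex.ofReal_exp]
  push_cast
  rfl

theorem exists_poisson : ∃ c : ℝ, 0 < c ∧ ∀ s : ℝ, 0 < s → ∀ v : E n,
    HasSum (fun w : dualLattice L =>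
      c * s ^ n * (rho (1 / s) (w : E n) * Real.cos (2 * Real.pi * inner ℝ (w : E n) v)))
      (shiftedMass s L v) := by
  set b := latticeBasis L
  obtain ⟨e, he⟩ := exists_equiv_dualLattice b
  set ψ : (Fin n → ℝ) ≃L[ℝ] E n :=
    (b.ofZLatticeBasis ℝ).equivFun.symm.toContinuousLinearEquiv with hψ
  have hψb : ∀ x, ψ x = ∑ i, x i • (b i : E n) := by
    intro x
    simp [hψ, Module.Basis.equivFun_symm_apply]
  have hin : ∀ k x, inner ℝ (e k : E n) (ψ x) = ∑ i, k i * x i := by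
    intro k x
    rw [hψb, inner_sum]
    refine Finset.sum_congr rfl fun i _ => ?_
    rw [inner_smul_right, he, mul_comm]
  have hhaar : (volume.map ψ).IsAddHaarMeasure := inferInstance
  obtain ⟨c, hc, hmap⟩ : ∃ c : ℝ, 0 < c ∧ ∀ h : E n → ℂ, ∫ x, h (ψ x) = c * ∫ y, h y := by
    refine ⟨Measure.addHaarScalarFactor (volume.map ψ) volume, ?_, fun h => ?_⟩
    · exact_mod_cast Measure.addHaarScalarFactor_pos_of_isAddHaarMeasure _ _
    · rw [show ∫ x, h (ψ x) = ∫ y, h y ∂(volume.map ψ) from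
        (ψ.toHomeomorph.measurableEmbedding.integral_map h).symm]
      conv_lhs => rw [Measure.isAddLeftInvariant_eq_smul (volume.map ψ) volume]
      rw [integral_smul_nnreal_measure]
      simp [NNReal.smul_def]
  refine ⟨c, hc, fun s hs v => ?_⟩
  have hmass : ∀ x, shiftedMass s L (ψ x) =
      ∑' m : Fin n → ℤ, rho s (ψ (x + fun i => (m i : ℝ))) := by
    intro x
    unfold shiftedMass
    rw [← (b.equivFun.symm.toEquiv.trans (Equiv.neg L)).tsum_eq]
    refine tsum_congr fun m => ?_
    rw [← rho_neg]
    congr 1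
    rw [map_add, hψb (fun i => (m i : ℝ))]
    simp [Module.Basis.equivFun_symm_apply, Int.cast_smul_eq_zsmul]
  have hF : ∀ k : Fin n → ℤ,
      ∫ x, UnitAddTorus.mFourier (-k) (toTorus x) * ((rho s (ψ x) : ℝ) : ℂ) =
        ((c * s ^ n * rho (1 / s) (e k : E n) : ℝ) : ℂ) := by
    intro k
    have := hmap fun y => Complex.exp (2 * Real.pi * Complex.I * (-inner ℝ (e k : E n) y : ℝ)) *
      (rho s y : ℂ)
    rw [fourier_rho hs] at this
    rw [mul_assoc, Complex.ofReal_mul, ← this]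
    congr 1
    ext x
    rw [mFourier_toTorus, hin]
    simp
  have hsum : Summable fun k : Fin n → ℤ => c * s ^ n * rho (1 / s) (e k : E n) :=
    ((e.summable_iff (f := fun w : dualLattice L => rho (1 / s) (w : E n))).2
      (summable_rho (dualLattice L) (by positivity))).mul_left _
  have hi : Integrable fun x => rho s (ψ x) := by
    refine (ψ.toHomeomorph.measurableEmbedding.integrable_map_iff (g := rho s)).1 ?_
    change Integrable (rho s) (volume.map ψ)
    rw [Measure.isAddLeftInvariant_eq_smul (volume.map ψ) volume]
    exact (integrable_rho hs).smul_measure_nnreal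
  obtain ⟨x, rfl⟩ := ψ.surjective v
  have hP := hasSum_poisson hi
    (((continuous_shiftedMass L hs.ne').comp ψ.continuous).congr hmass)
    (by simp_rw [hF]; exact Complex.summable_ofReal.2 hsum) x
  rw [← hmass] at hP
  have hre := Complex.hasSum_re hP
  rw [← e.hasSum_iff]
  rw [Complex.ofReal_re] at hre
  convert hre using 1
  ext k
  rw [hF, mFourier_toTorus, Complex.re_ofReal_mul, Function.comp_apply, hin, ← mul_assoc]
  congr 1
  rw [← Complex.exp_ofReal_mul_I_re]
  congr 2
  push_cast
  ring

end LatticePoisson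

end GDD

namespace GDD

open Filter Topology

/-! ### The smoothing parameter -/

section Eta

variable {n : ℕ} (L : Submodule ℤ (E n)) [DiscreteTopology L]

theorem rhoLattice_inv_strictAnti {w₀ : E n} (hw : w₀ ∈ L) (hw0 : w₀ ≠ 0) :
    StrictAntiOn (fun s => rhoLattice (1 / s) L) (Set.Ioi 0) := by
  intro s hs r hr hsr
  have hs : 0 < s := hs
  have hr : 0 < r := hr
  have h1r : 0 < 1 / r := by positivity
  refine (summable_rho L h1r.ne').tsum_lt_tsum (i := ⟨w₀, hw⟩) (fun y => ?_) ?_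
    (summable_rho L (by positivity))
  · exact rho_mono_scale h1r (one_div_le_one_div_of_le hs hsr.le) _
  · have := Real.pi_pos
    have hn : 0 < ‖w₀‖ := norm_pos_iff.2 hw0
    simp only [rho, one_div, inv_pow, div_inv_eq_mul]
    apply Real.exp_lt_exp.2
    have : s ^ 2 < r ^ 2 := by gcongr
    nlinarith [mul_pos Real.pi_pos (pow_pos hn 2)]

theorem continuousOn_rhoLattice_inv :
    ContinuousOn (fun s => rhoLattice (1 / s) L) (Set.Ioi 0) := by
  intro r hr
  have hr : 0 < r := hr
  have hc : ContinuousOn (fun s => rhoLattice (1 / s) L) (Set.Ioi (r / 2)) := by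
    have h2 : 0 < r / 2 := by positivity
    refine continuousOn_tsum (u := fun y : L => rho (1 / (r / 2)) (y : E n)) (fun y => ?_)
      (summable_rho L (by positivity)) fun y s hs => ?_
    · simp only [rho, one_div, inv_pow, div_inv_eq_mul]
      fun_prop
    · have hs : r / 2 < s := hs
      rw [Real.norm_of_nonneg (rho_pos _ _).le]
      exact rho_mono_scale (one_div_pos.2 (h2.trans hs)) (one_div_le_one_div_of_le h2 hs.le) _
  exact (hc.continuousAt (Ioi_mem_nhds (by linarith))).continuousWithinAt

theorem tendsto_rhoLattice_inv_atTop :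
    Tendsto (fun s => rhoLattice (1 / s) L) atTop (𝓝 1) := by
  have h : Tendsto (fun s => rhoLattice (1 / s) L) atTop
      (𝓝 (∑' y : L, if y = 0 then (1 : ℝ) else 0)) := by
    refine tendsto_tsum_of_dominated_convergence (bound := fun y : L => rho (1 / 1) (y : E n))
      (summable_rho L (by norm_num)) (fun y => ?_) ?_
    · split_ifs with hy
      · simp [hy]
      · have hn : 0 < ‖(y : E n)‖ := norm_pos_iff.2 (by simpa using hy)
        simp only [rho, one_div, inv_pow, div_inv_eq_mul]
        refine Real.tendsto_exp_atBot.comp ?_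
        refine Tendsto.const_mul_atTop_of_neg ?_ (tendsto_pow_atTop two_ne_zero)
        have := mul_pos Real.pi_pos (pow_pos hn 2)
        linarith
    · filter_upwards [eventually_ge_atTop 1] with s hs y
      rw [Real.norm_of_nonneg (rho_pos _ _).le]
      exact rho_mono_scale (by positivity) (one_div_le_one_div_of_le one_pos hs) _
  simpa [rhoLattice] using h

theorem one_add_rho_le {s : ℝ} (hs : s ≠ 0) {w : E n} (hw : w ∈ L) (hw0 : w ≠ 0) :
    1 + rho s w ≤ rhoLattice s L := by
  have h := (summable_rho L hs).sum_le_tsum ({0, ⟨w, hw⟩} : Finset L)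
    fun y _ => (rho_pos s (y : E n)).le
  rw [Finset.sum_pair (by simpa [Subtype.ext_iff] using hw0.symm)] at h
  simpa [rhoLattice] using h

variable [IsZLattice ℝ L]

theorem exists_dual_ne_zero (hn : 0 < n) : ∃ w ∈ dualLattice L, w ≠ 0 := by
  obtain ⟨e, -⟩ := exists_equiv_dualLattice (latticeBasis L)
  have : Nonempty (Fin n) := ⟨⟨0, hn⟩⟩
  have := e.symm.nontrivial
  obtain ⟨w, hw⟩ := exists_ne (0 : dualLattice L)
  exact ⟨w, w.2, by simpa using hw⟩

theorem eta_spec (hn : 0 < n) :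
    0 < eta L ∧ rhoLattice (1 / eta L) (dualLattice L) = 3 / 2 := by
  obtain ⟨w, hw, hw0⟩ := exists_dual_ne_zero L hn
  set θ : ℝ → ℝ := fun s => rhoLattice (1 / s) (dualLattice L) with hθ
  have hanti := rhoLattice_inv_strictAnti (dualLattice L) hw hw0
  obtain ⟨r, hr0, hr⟩ : ∃ r, 0 < r ∧ θ r ≤ 3 / 2 := by
    have h := ((tendsto_rhoLattice_inv_atTop (dualLattice L)).eventually
      (ge_mem_nhds (show (1 : ℝ) < 3 / 2 by norm_num))).and (eventually_gt_atTop 0)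
    obtain ⟨r, h1, h2⟩ := h.exists
    exact ⟨r, h2, h1⟩
  obtain ⟨q, hq0, hq⟩ : ∃ q, 0 < q ∧ 3 / 2 ≤ θ q := by
    have hc : ContinuousAt (fun s : ℝ => Real.exp (-Real.pi * ‖w‖ ^ 2 * s ^ 2)) 0 := by
      fun_prop
    have h : ∀ᶠ s in 𝓝[>] (0 : ℝ), 1 / 2 ≤ Real.exp (-Real.pi * ‖w‖ ^ 2 * s ^ 2) :=
      (hc.eventually (le_mem_nhds (by simp; norm_num))).filter_mono nhdsWithin_le_nhds
    obtain ⟨q, h1, h2⟩ := (h.and self_mem_nhdsWithin).exists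
    have h2 : 0 < q := h2
    refine ⟨q, h2, ?_⟩
    have h3 := one_add_rho_le (dualLattice L) (s := 1 / q) (by positivity) hw hw0
    have h4 : rho (1 / q) w = Real.exp (-Real.pi * ‖w‖ ^ 2 * q ^ 2) := by
      simp only [rho, one_div, inv_pow, div_inv_eq_mul]
    rw [h4] at h3
    simp only [hθ]
    linarith
  have hqr : q ≤ r := by
    by_contra! hlt
    have := hanti (Set.mem_Ioi.2 hr0) (Set.mem_Ioi.2 hq0) hlt
    simp only [hθ] at hr hq
    dsimp only at this
    linarith
  obtain ⟨s, hs, hsv⟩ := intermediate_value_Icc' hqr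
    ((continuousOn_rhoLattice_inv (dualLattice L)).mono fun x hx => hq0.trans_le hx.1)
    (show (3 / 2 : ℝ) ∈ Set.Icc _ _ from ⟨hr, hq⟩)
  have hs0 : 0 < s := hq0.trans_le hs.1
  have hset : {s : ℝ | 0 < s ∧ rhoLattice (1 / s) (dualLattice L) = 3 / 2} = {s} := by
    ext x
    constructor
    · rintro ⟨hx, hxv⟩
      exact hanti.injOn (Set.mem_Ioi.2 hx) (Set.mem_Ioi.2 hs0) (hxv.trans hsv.symm)
    · rintro rfl
      exact ⟨hs0, hsv⟩
  have : eta L = s := by rw [eta, hset, csInf_singleton]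
  rw [this]
  exact ⟨hs0, hsv⟩

theorem eta_pos (hn : 0 < n) : 0 < eta L := (eta_spec L hn).1

theorem half_le_of_mem_dual (hn : 0 < n) {w : E n} (hw : w ∈ dualLattice L) (hw0 : w ≠ 0) :
    1 / 2 ≤ Real.pi * ‖w‖ ^ 2 * eta L ^ 2 := by
  obtain ⟨h0, h1⟩ := eta_spec L hn
  have h2 := one_add_rho_le (dualLattice L) (s := 1 / eta L) (by positivity) hw hw0
  have h3 : rho (1 / eta L) w = Real.exp (-(Real.pi * ‖w‖ ^ 2 * eta L ^ 2)) := by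
    simp only [rho, one_div, inv_pow, div_inv_eq_mul, neg_mul]
  have h4 := Real.one_sub_le_exp_neg (Real.pi * ‖w‖ ^ 2 * eta L ^ 2)
  rw [h3, h1] at h2
  linarith

theorem shiftedMass_le {s : ℝ} (hs : 0 < s) (v : E n) : shiftedMass s L v ≤ shiftedMass s L 0 := by
  obtain ⟨c, hc, h⟩ := exists_poisson L
  refine hasSum_le (fun w => ?_) (h s hs v) (h s hs 0)
  have := rho_pos (1 / s) (w : E n)
  gcongr
  simpa using Real.cos_le_one _

theorem shiftedMass_two_mul_le {s : ℝ} (hs : 0 < s) :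
    shiftedMass (2 * s) L 0 ≤ 2 ^ n * shiftedMass s L 0 := by
  obtain ⟨c, hc, h⟩ := exists_poisson L
  refine hasSum_le (fun w => ?_) (h (2 * s) (by positivity) 0) ((h s hs 0).mul_left (2 ^ n))
  have h1 : rho (1 / (2 * s)) (w : E n) ≤ rho (1 / s) (w : E n) :=
    rho_mono_scale (by positivity) (one_div_le_one_div_of_le hs (by linarith)) _
  simp only [inner_zero_right, mul_zero, Real.cos_zero, mul_one, mul_pow]
  have : c * (2 ^ n * s ^ n) * rho (1 / (2 * s)) (w : E n) ≤
    c * (2 ^ n * s ^ n) * rho (1 / s) (w : E n) := by gcongr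
  linarith

theorem shiftedMass_eta_ge (hn : 0 < n) (v : E n) :
    shiftedMass (eta L) L 0 ≤ 3 * shiftedMass (eta L) L v := by
  obtain ⟨c, hc, h⟩ := exists_poisson L
  obtain ⟨h0, h1⟩ := eta_spec L hn
  set s := eta L
  have hsum := (summable_rho (dualLattice L) (s := 1 / s) (by positivity)).hasSum
  change HasSum _ (rhoLattice (1 / s) (dualLattice L)) at hsum
  rw [h1] at hsum
  have hF0 : shiftedMass s L 0 = c * s ^ n * (3 / 2) := by
    refine (h s h0 0).unique ?_
    simpa using hsum.mul_left (c * s ^ n)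
  have hlow : HasSum (fun w : dualLattice L =>
      c * s ^ n * (2 * (if w = 0 then 1 else 0) - rho (1 / s) (w : E n)))
      (c * s ^ n * (2 * 1 - 3 / 2)) :=
    (((hasSum_ite_eq (0 : dualLattice L) (1 : ℝ)).mul_left 2).sub hsum).mul_left _
  have hle := hasSum_le (fun w => ?_) hlow (h s h0 v)
  · rw [hF0]; linarith
  · gcongr
    split_ifs with hw
    · simp [hw]; norm_num
    · have := rho_pos (1 / s) (w : E n)
      have := Real.neg_one_le_cos (2 * Real.pi * inner ℝ (w : E n) v)
      nlinarith

end Eta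

/-! ### Lower bounds for Gaussian tails on a lattice -/

section Tail

variable {n : ℕ} (L : Submodule ℤ (E n))

/-- The lattice vectors whose component along `u` is at least `β` and whose squared norm is at most
`R`. -/
def capSet (u : E n) (β R : ℝ) : Set L :=
  {y | β ≤ inner ℝ u (y : E n) ∧ ‖(y : E n)‖ ^ 2 ≤ R}

theorem hasSum_rho_tilt [DiscreteTopology L] {s : ℝ} (hs : 0 < s) (v w : E n) :
    HasSum (fun y : L => rho s ((y : E n) - v) *
        Real.exp (2 * Real.pi * inner ℝ w ((y : E n) - v) / s ^ 2))
      (Real.exp (Real.pi * ‖w‖ ^ 2 / s ^ 2) * shiftedMass s L (v + w)) := by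
  simp_rw [rho_tilt hs.ne', sub_sub]
  exact (summable_rho_sub L hs.ne' (v + w)).hasSum.mul_left _

theorem exp_tail_numeric (hn : 40 ≤ n) :
    2 * Real.exp (-Real.pi) + Real.exp (-(3 * Real.pi * n / 8)) * 2 ^ n ≤ 1 / 3 - 1 / 5 := by
  have hpi := Real.pi_gt_three
  have he := Real.exp_one_gt_d9
  have he3 : (20 : ℝ) ≤ Real.exp 3 := by
    rw [show (3 : ℝ) = (3 : ℕ) * 1 by norm_num, Real.exp_nat_mul]
    calc (20 : ℝ) ≤ 2.718 ^ 3 := by norm_num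
      _ ≤ _ := by gcongr; linarith
  have h1 : Real.exp (-Real.pi) ≤ 1 / 20 := by
    rw [Real.exp_neg, one_div]
    exact inv_anti₀ (by norm_num) (he3.trans (Real.exp_le_exp.2 hpi.le))
  have h2 : Real.exp (-(3 * Real.pi * n / 8)) ≤ Real.exp (-1) ^ n := by
    rw [← Real.exp_nat_mul]
    apply Real.exp_le_exp.2
    have : (0 : ℝ) ≤ n := by positivity
    nlinarith
  have h3 : Real.exp (-1) * 2 ≤ 3 / 4 := by
    rw [Real.exp_neg]
    have : (Real.exp 1)⁻¹ ≤ (2.7 : ℝ)⁻¹ := inv_anti₀ (by norm_num) (by linarith)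
    norm_num at this
    linarith
  have h4 : Real.exp (-(3 * Real.pi * n / 8)) * 2 ^ n ≤ (3 / 4) ^ 40 := by
    calc _ ≤ Real.exp (-1) ^ n * 2 ^ n := by gcongr
      _ = (Real.exp (-1) * 2) ^ n := by rw [mul_pow]
      _ ≤ (3 / 4) ^ n := by gcongr
      _ ≤ (3 / 4) ^ 40 := pow_le_pow_of_le_one (by norm_num) (by norm_num) hn
  have h5 : ((3 : ℝ) / 4) ^ 40 ≤ 1 / 30 := by norm_num
  linarith

theorem rho_le_cap_add_tails {s : ℝ} (hs : 0 < s) {u : E n} (hu : ‖u‖ = 1) {τ : ℝ} (hτ : 0 ≤ τ)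
    (y : L) :
    rho s ((y : E n) - (τ * s) • u) ≤
      Real.exp (Real.pi * τ ^ 2 + 2 * Real.pi * τ) *
        (capSet L u ((τ - 1) * s) ((n / 2 + 2 * τ + τ ^ 2) * s ^ 2)).indicator
          (fun y : L => rho s (y : E n)) y +
      Real.exp (-(2 * Real.pi)) * (rho s ((y : E n) - (τ * s) • u) *
        Real.exp (2 * Real.pi * inner ℝ (s • u) ((y : E n) - (τ * s) • u) / s ^ 2)) +
      Real.exp (-(2 * Real.pi)) * (rho s ((y : E n) - (τ * s) • u) *
        Real.exp (2 * Real.pi * inner ℝ (-(s • u)) ((y : E n) - (τ * s) • u) / s ^ 2)) +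
      Real.exp (-(3 * Real.pi * n / 8)) * rho (2 * s) ((y : E n) - (τ * s) • u) := by
  set x := (y : E n) - (τ * s) • u with hx
  have hpi := Real.pi_pos
  have hρ := rho_pos s x
  have hρ2 := rho_pos (2 * s) x
  have hA : 0 ≤ (capSet L u ((τ - 1) * s) ((n / 2 + 2 * τ + τ ^ 2) * s ^ 2)).indicator
          (fun y : L => rho s (y : E n)) y :=
    Set.indicator_nonneg (fun (z : L) _ => (rho_pos s (z : E n)).le) y
  have e1 : 0 ≤ Real.exp (Real.pi * τ ^ 2 + 2 * Real.pi * τ) *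
        (capSet L u ((τ - 1) * s) ((n / 2 + 2 * τ + τ ^ 2) * s ^ 2)).indicator
          (fun y : L => rho s (y : E n)) y := by positivity
  have hside : ∀ w : E n, s ^ 2 ≤ inner ℝ w x → rho s x ≤ Real.exp (-(2 * Real.pi)) *
      (rho s x * Real.exp (2 * Real.pi * inner ℝ w x / s ^ 2)) := by
    intro w hw
    have : 1 ≤ Real.exp (-(2 * Real.pi)) * Real.exp (2 * Real.pi * inner ℝ w x / s ^ 2) := by
      rw [← Real.exp_add, Real.one_le_exp_iff]
      have : 1 ≤ inner ℝ w x / s ^ 2 := by rwa [one_le_div (by positivity)]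
      rw [mul_div_assoc]
      nlinarith
    nlinarith
  have hpos : ∀ w : E n, 0 ≤ Real.exp (-(2 * Real.pi)) *
      (rho s x * Real.exp (2 * Real.pi * inner ℝ w x / s ^ 2)) := fun w => by positivity
  have e2 := hpos (s • u)
  have e3 := hpos (-(s • u))
  have e4 : 0 ≤ Real.exp (-(3 * Real.pi * n / 8)) * rho (2 * s) x := by positivity
  by_cases c1 : s ^ 2 ≤ inner ℝ (s • u) x
  · linarith [hside _ c1]
  by_cases c2 : s ^ 2 ≤ inner ℝ (-(s • u)) x
  · linarith [hside _ c2]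
  by_cases c3 : n / 2 * s ^ 2 ≤ ‖x‖ ^ 2
  · suffices rho s x ≤ Real.exp (-(3 * Real.pi * n / 8)) * rho (2 * s) x by linarith
    unfold rho
    rw [← Real.exp_add]
    apply Real.exp_le_exp.2
    have : n / 2 ≤ ‖x‖ ^ 2 / s ^ 2 := by rwa [le_div_iff₀ (by positivity)]
    have h1 : -Real.pi * ‖x‖ ^ 2 / s ^ 2 = -Real.pi * (‖x‖ ^ 2 / s ^ 2) := by ring
    have h2 : -Real.pi * ‖x‖ ^ 2 / (2 * s) ^ 2 = -Real.pi / 4 * (‖x‖ ^ 2 / s ^ 2) := by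
      field_simp; norm_num
    rw [h1, h2]
    nlinarith
  push Not at c1 c2 c3
  rw [inner_neg_left, inner_smul_left] at c2
  rw [inner_smul_left] at c1
  simp only [conj_trivial] at c1 c2
  have c1' : inner ℝ u x < s := by nlinarith
  have c2' : -s < inner ℝ u x := by nlinarith
  have hy : (y : E n) = x + (τ * s) • u := by rw [hx]; abel
  have hmem : y ∈ capSet L u ((τ - 1) * s) ((n / 2 + 2 * τ + τ ^ 2) * s ^ 2) := by
    constructor
    · rw [hy, inner_add_right, inner_smul_right, real_inner_self_eq_norm_sq, hu]
      nlinarith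
    · rw [hy, @norm_add_sq_real, inner_smul_right, real_inner_comm, norm_smul, hu,
        Real.norm_of_nonneg (by positivity)]
      have : τ * s * inner ℝ u x ≤ τ * s * s := by gcongr
      nlinarith
  suffices rho s x ≤ Real.exp (Real.pi * τ ^ 2 + 2 * Real.pi * τ) * rho s (y : E n) by
    rw [Set.indicator_of_mem hmem]
    linarith
  unfold rho
  rw [← Real.exp_add]
  apply Real.exp_le_exp.2
  rw [hy, @norm_add_sq_real, inner_smul_right, real_inner_comm, norm_smul, hu,
        Real.norm_of_nonneg (by positivity)]
  have h1 : -Real.pi * (‖x‖ ^ 2 + 2 * (τ * s * inner ℝ u x) + (τ * s * 1) ^ 2) / s ^ 2 =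
    -Real.pi * ‖x‖ ^ 2 / s ^ 2 - 2 * Real.pi * τ * (inner ℝ u x / s) - Real.pi * τ ^ 2 := by
    field_simp
    ring
  have h2 : inner ℝ u x / s ≤ 1 := by rw [div_le_one hs]; exact c1'.le
  rw [h1]
  have : 2 * Real.pi * τ * (inner ℝ u x / s) ≤ 2 * Real.pi * τ * 1 := by gcongr
  linarith

variable [DiscreteTopology L] [IsZLattice ℝ L]

theorem cap_mass_ge (hn : 40 ≤ n) {u : E n} (hu : ‖u‖ = 1) {τ : ℝ} (hτ : 0 ≤ τ) :
    Real.exp (-(Real.pi * τ ^ 2 + 2 * Real.pi * τ)) / 5 * rhoLattice (eta L) L ≤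
      ∑' y : L, (capSet L u ((τ - 1) * eta L) ((n / 2 + 2 * τ + τ ^ 2) * eta L ^ 2)).indicator
        (fun y : L => rho (eta L) (y : E n)) y := by
  have hn0 : 0 < n := by omega
  have hs := eta_pos L hn0
  have hlow := fun v => shiftedMass_eta_ge L hn0 v
  set s := eta L
  set v := (τ * s) • u with hv
  have hpi := Real.pi_pos
  have hind := ((summable_rho L hs.ne').indicator
    (capSet L u ((τ - 1) * s) ((n / 2 + 2 * τ + τ ^ 2) * s ^ 2))).hasSum
  set S := ∑' y : L, (capSet L u ((τ - 1) * s) ((n / 2 + 2 * τ + τ ^ 2) * s ^ 2)).indicator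
        (fun y : L => rho s (y : E n)) y
  have hle := hasSum_le (rho_le_cap_add_tails L hs hu hτ) (summable_rho_sub L hs.ne' v).hasSum
    ((((hind.mul_left (Real.exp (Real.pi * τ ^ 2 + 2 * Real.pi * τ))).add
      ((hasSum_rho_tilt L hs v (s • u)).mul_left (Real.exp (-(2 * Real.pi))))).add
      ((hasSum_rho_tilt L hs v (-(s • u))).mul_left (Real.exp (-(2 * Real.pi))))).add
      ((summable_rho_sub L (s := 2 * s) (by positivity) v).hasSum.mul_left
        (Real.exp (-(3 * Real.pi * n / 8)))))
  change shiftedMass s L v ≤ _ + _ * shiftedMass (2 * s) L v at hle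
  have hns : ‖s • u‖ = s := by rw [norm_smul, hu, Real.norm_of_nonneg hs.le, mul_one]
  have hexp : Real.exp (Real.pi * s ^ 2 / s ^ 2) = Real.exp Real.pi := by
    congr 1; field_simp
  have hee : Real.exp (-(2 * Real.pi)) * Real.exp Real.pi = Real.exp (-Real.pi) := by
    rw [← Real.exp_add]; congr 1; ring
  rw [norm_neg, hns, hexp, ← mul_assoc, ← mul_assoc, hee] at hle
  set F := shiftedMass s L 0 with hF
  have hFpos : 0 < F := shiftedMass_pos L hs.ne' 0
  have b1 := shiftedMass_le L hs (v + s • u)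
  have b2 := shiftedMass_le L hs (v + -(s • u))
  have b3 := (shiftedMass_le L (s := 2 * s) (by positivity) v).trans (shiftedMass_two_mul_le L hs)
  have b4 := hlow v
  have hnum := exp_tail_numeric hn
  have t1 : Real.exp (-Real.pi) * shiftedMass s L (v + s • u) ≤ Real.exp (-Real.pi) * F := by gcongr
  have t2 : Real.exp (-Real.pi) * shiftedMass s L (v + -(s • u)) ≤ Real.exp (-Real.pi) * F := by
    gcongr
  have t3 : Real.exp (-(3 * Real.pi * n / 8)) * shiftedMass (2 * s) L v ≤
    Real.exp (-(3 * Real.pi * n / 8)) * (2 ^ n * F) := by gcongr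
  have t4 : (2 * Real.exp (-Real.pi) + Real.exp (-(3 * Real.pi * n / 8)) * 2 ^ n) * F ≤
    (1 / 3 - 1 / 5) * F := by gcongr
  have key : F / 5 ≤ Real.exp (Real.pi * τ ^ 2 + 2 * Real.pi * τ) * S := by linarith
  rw [rhoLattice_eq_shiftedMass, ← hF, Real.exp_neg, div_mul_eq_mul_div, mul_div_assoc,
    inv_mul_le_iff₀ (Real.exp_pos _)]
  exact key

end Tail

end GDD

namespace GDD

open Filter Topology

/-! ### Samples from the discrete Gaussian -/

section Samples

variable {n : ℕ} (L : Submodule ℤ (E n)) [DiscreteTopology L]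

theorem rhoLattice_pos {s : ℝ} (hs : s ≠ 0) : 0 < rhoLattice s L := by
  rw [rhoLattice_eq_shiftedMass]; exact shiftedMass_pos L hs 0

theorem measurableSet_lattice [IsZLattice ℝ L] (A : Set L) : MeasurableSet A :=
  A.to_countable.measurableSet

theorem discreteGaussian_apply [IsZLattice ℝ L] {s : ℝ} (hs : s ≠ 0) (A : Set L) :
    discreteGaussian L s A =
      ENNReal.ofReal ((∑' y : L, A.indicator (fun y : L => rho s (y : E n)) y) / rhoLattice s L) := by
  have hA := measurableSet_lattice L A
  have hpos := rhoLattice_pos L hs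
  rw [discreteGaussian, Measure.sum_apply _ hA, ← tsum_div_const, ENNReal.ofReal_tsum_of_nonneg]
  · refine tsum_congr fun y => ?_
    rw [Measure.smul_apply, Measure.dirac_apply' _ hA]
    by_cases h : y ∈ A <;> simp [h]
  · intro y
    exact div_nonneg (Set.indicator_nonneg (fun (z : L) _ => (rho_pos s (z : E n)).le) y) hpos.le
  · exact ((summable_rho L hs).indicator A).div_const _

theorem isProbabilityMeasure_discreteGaussian [IsZLattice ℝ L] {s : ℝ} (hs : s ≠ 0) :
    IsProbabilityMeasure (discreteGaussian L s) := by
  constructor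
  rw [discreteGaussian_apply L hs]
  simp only [Set.indicator_univ]
  change ENNReal.ofReal (rhoLattice s L / rhoLattice s L) = 1
  rw [div_self (rhoLattice_pos L hs).ne', ENNReal.ofReal_one]

theorem pi_forall_notMem_le {Ω : Type*} [MeasurableSpace Ω] (μ : Measure Ω)
    [IsProbabilityMeasure μ] {A : Set Ω} (hA : MeasurableSet A) {p : ℝ}
    (hp : ENNReal.ofReal p ≤ μ A) (N : ℕ) :
    (Measure.pi fun _ : Fin N => μ) {y | ∀ i, y i ∉ A} ≤ ENNReal.ofReal (Real.exp (-(N * p))) := by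
  have hset : {y : Fin N → Ω | ∀ i, y i ∉ A} = Set.univ.pi fun _ => Aᶜ := by
    ext y; simp
  have h1 : μ Aᶜ ≤ ENNReal.ofReal (Real.exp (-p)) := by
    rw [prob_compl_eq_one_sub hA]
    calc 1 - μ A ≤ 1 - ENNReal.ofReal p := by gcongr
      _ ≤ ENNReal.ofReal (1 - p) := by
        rw [tsub_le_iff_right]
        calc (1 : ℝ≥0∞) = ENNReal.ofReal ((1 - p) + p) := by simp
          _ ≤ _ := ENNReal.ofReal_add_le
      _ ≤ _ := ENNReal.ofReal_le_ofReal (Real.one_sub_le_exp_neg p)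
  rw [hset, Measure.pi_pi, Finset.prod_const, Finset.card_univ, Fintype.card_fin]
  calc (μ Aᶜ) ^ N ≤ ENNReal.ofReal (Real.exp (-p)) ^ N := by gcongr
    _ = _ := by
      rw [← ENNReal.ofReal_pow (Real.exp_pos _).le, ← Real.exp_nat_mul]
      congr 2; ring

end Samples

/-! ### A net on the unit sphere -/

section Net

variable {n : ℕ}

/-- The grid cell of mesh `1 / (8 n)` that contains `u`. -/
noncomputable def gridCell (u : E n) : Fin n → ℤ := fun i => round (8 * (n : ℝ) * u i)

/-- The labels of the grid cells that meet the unit sphere. -/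
noncomputable def gridBox (n : ℕ) : Finset (Fin n → ℤ) :=
  Fintype.piFinset fun _ => Finset.Icc (-(8 * n : ℤ)) (8 * n)

theorem card_gridBox : (gridBox n).card = (16 * n + 1) ^ n := by
  simp only [gridBox, Fintype.card_piFinset, Int.card_Icc, Finset.prod_const, Finset.card_univ,
    Fintype.card_fin]
  congr 1
  omega

theorem gridCell_mem {u : E n} (hu : ‖u‖ = 1) : gridCell u ∈ gridBox n := by
  simp only [gridBox, Fintype.mem_piFinset, Finset.mem_Icc, gridCell]
  intro i
  have h : |u i| ≤ 1 := by
    have h2 := PiLp.norm_apply_le u i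
    rwa [hu, Real.norm_eq_abs] at h2
  obtain ⟨h1, h2⟩ := abs_le.1 h
  have hn : (0 : ℝ) ≤ 8 * n := by positivity
  have hr := abs_le.1 (abs_sub_round (8 * (n : ℝ) * u i))
  have a1 : (round (8 * (n : ℝ) * u i) : ℝ) < 8 * n + 1 := by nlinarith
  have a2 : -(8 * n : ℝ) - 1 < (round (8 * (n : ℝ) * u i) : ℝ) := by nlinarith
  constructor
  · have : (-(8 * n : ℤ) - 1) < round (8 * (n : ℝ) * u i) := by exact_mod_cast a2
    omega
  · have : round (8 * (n : ℝ) * u i) < (8 * n : ℤ) + 1 := by exact_mod_cast a1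
    omega

theorem norm_sub_sq_le_of_gridCell_eq (hn : 0 < n) {u v : E n} (h : gridCell u = gridCell v) :
    ‖u - v‖ ^ 2 * n ≤ (1 / 8) ^ 2 := by
  have hn' : (0 : ℝ) < n := by exact_mod_cast hn
  have hi : ∀ i, |(u - v) i| ≤ 1 / (8 * n) := by
    intro i
    have h1 := abs_sub_round (8 * (n : ℝ) * u i)
    have h2 := abs_sub_round (8 * (n : ℝ) * v i)
    have h3 : round (8 * (n : ℝ) * u i) = round (8 * (n : ℝ) * v i) := congrFun h i
    rw [h3] at h1
    rw [abs_le] at h1 h2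
    rw [le_div_iff₀ (by positivity), PiLp.sub_apply]
    rw [show |u i - v i| * (8 * (n : ℝ)) = |8 * (n : ℝ) * u i - 8 * n * v i| by
      rw [← mul_sub, abs_mul, abs_of_pos (show (0 : ℝ) < 8 * n by positivity), mul_comm], abs_le]
    constructor <;> linarith
  rw [EuclideanSpace.norm_sq_eq]
  have : ∑ i, ‖(u - v) i‖ ^ 2 ≤ ∑ _i : Fin n, (1 / (8 * (n : ℝ))) ^ 2 := by
    refine Finset.sum_le_sum fun i _ => ?_
    rw [Real.norm_eq_abs]
    exact pow_le_pow_left₀ (abs_nonneg _) (hi i) 2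
  rw [Finset.sum_const, Finset.card_univ, Fintype.card_fin, nsmul_eq_mul] at this
  calc _ ≤ (n * (1 / (8 * (n : ℝ))) ^ 2) * n := by gcongr
    _ = _ := by field_simp

theorem capSet_mono_of_gridCell_eq (L : Submodule ℤ (E n)) (hn : 0 < n) {s : ℝ} (hs : 0 < s)
    {u v : E n} (h : gridCell u = gridCell v) {β R : ℝ} (hR : R ≤ n) :
    capSet L v ((β + 1 / 8) * s) (R * s ^ 2) ⊆ capSet L u (β * s) (R * s ^ 2) := by
  rintro y ⟨h1, h2⟩
  refine ⟨?_, h2⟩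
  have hd := norm_sub_sq_le_of_gridCell_eq hn h
  have hyn : ‖(y : E n)‖ ^ 2 ≤ n * s ^ 2 := h2.trans (by gcongr)
  have hcs : |inner ℝ (u - v) (y : E n)| ≤ 1 / 8 * s := by
    refine (abs_real_inner_le_norm _ _).trans (abs_le_of_sq_le_sq' ?_ (by positivity)).2
    calc (‖u - v‖ * ‖(y : E n)‖) ^ 2 = ‖u - v‖ ^ 2 * ‖(y : E n)‖ ^ 2 := by ring
      _ ≤ ‖u - v‖ ^ 2 * (n * s ^ 2) := by gcongr
      _ = ‖u - v‖ ^ 2 * n * s ^ 2 := by ring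
      _ ≤ (1 / 8) ^ 2 * s ^ 2 := by gcongr
      _ = _ := by ring
  rw [inner_sub_left] at hcs
  have := (abs_le.1 hcs).1
  linarith

theorem measure_uncovered_le (L : Submodule ℤ (E n)) [DiscreteTopology L] [IsZLattice ℝ L]
    (hn : 0 < n) {s : ℝ} (hs : 0 < s) {β R p : ℝ} (hR : R ≤ n)
    (hp : ∀ u : E n, ‖u‖ = 1 →
      ENNReal.ofReal p ≤ discreteGaussian L s (capSet L u ((β + 1 / 8) * s) (R * s ^ 2)))
    (N : ℕ) :
    (Measure.pi fun _ : Fin N => discreteGaussian L s)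
      {y | ∃ u : E n, ‖u‖ = 1 ∧ ∀ i, y i ∉ capSet L u (β * s) (R * s ^ 2)} ≤
      ENNReal.ofReal ((16 * n + 1) ^ n * Real.exp (-(N * p))) := by
  classical
  have := isProbabilityMeasure_discreteGaussian L hs.ne'
  have hcover : {y : Fin N → L | ∃ u : E n, ‖u‖ = 1 ∧ ∀ i, y i ∉ capSet L u (β * s) (R * s ^ 2)} ⊆
      ⋃ c ∈ gridBox n, {y | ∃ u : E n, (‖u‖ = 1 ∧ gridCell u = c) ∧
        ∀ i, y i ∉ capSet L u (β * s) (R * s ^ 2)} := by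
    rintro y ⟨u, hu, hy⟩
    exact Set.mem_biUnion (gridCell_mem hu) ⟨u, ⟨hu, rfl⟩, hy⟩
  have hcell : ∀ c ∈ gridBox n, (Measure.pi fun _ : Fin N => discreteGaussian L s)
      {y | ∃ u : E n, (‖u‖ = 1 ∧ gridCell u = c) ∧ ∀ i, y i ∉ capSet L u (β * s) (R * s ^ 2)} ≤
        ENNReal.ofReal (Real.exp (-(N * p))) := by
    intro c _
    by_cases hc : ∃ v : E n, ‖v‖ = 1 ∧ gridCell v = c
    · obtain ⟨v, hv, hvc⟩ := hc
      refine (measure_mono ?_).trans (pi_forall_notMem_le _ (measurableSet_lattice L _) (hp v hv) N)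
      rintro y ⟨u, ⟨hu, huc⟩, hy⟩ i hi
      exact hy i (capSet_mono_of_gridCell_eq L hn hs (huc.trans hvc.symm) hR hi)
    · refine le_of_eq_of_le (measure_mono_null ?_ measure_empty) bot_le
      rintro y ⟨u, hu, -⟩
      exact hc ⟨u, hu⟩
  refine (measure_mono hcover).trans ((measure_biUnion_finset_le _ _).trans
    ((Finset.sum_le_sum hcell).trans ?_))
  rw [Finset.sum_const, card_gridBox, nsmul_eq_mul, ENNReal.ofReal_mul (by positivity)]
  gcongr
  rw [← ENNReal.ofReal_natCast]
  push_cast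
  rfl

end Net

/-! ### Numerical estimates -/

section Numeric

variable {n : ℕ} {α : ℝ}

theorem one_le_rpow_half_sub (hn : 40 ≤ n) (h2 : α ≤ 1 / 2) : 1 ≤ (n : ℝ) ^ (1 / 2 - α) :=
  Real.one_le_rpow (by exact_mod_cast (by omega : 1 ≤ n)) (by linarith)

theorem rpow_half_sub_sq_le (hn : 40 ≤ n) (h1 : 2 / Real.logb 2 n ≤ α) :
    ((n : ℝ) ^ (1 / 2 - α)) ^ 2 ≤ n / 16 := by
  have hn' : (40 : ℝ) ≤ n := by exact_mod_cast hn
  have hn0 : (0 : ℝ) < n := by linarith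
  have hlog : 0 < Real.logb 2 n := Real.logb_pos (by norm_num) (by linarith)
  have h4 : (4 : ℝ) ≤ (n : ℝ) ^ α := by
    have : (2 : ℝ) ^ (2 : ℝ) ≤ ((2 : ℝ) ^ Real.logb 2 n) ^ α := by
      rw [← Real.rpow_mul (by norm_num)]
      apply Real.rpow_le_rpow_of_exponent_le (by norm_num)
      rw [div_le_iff₀ hlog] at h1
      linarith
    rw [Real.rpow_logb (by norm_num) (by norm_num) hn0] at this
    norm_num at this
    exact this
  rw [← Real.rpow_natCast, ← Real.rpow_mul hn0.le,
    show (1 / 2 - α) * ((2 : ℕ) : ℝ) = 1 - (α + α) by push_cast; ring, Real.rpow_sub hn0,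
    Real.rpow_one, Real.rpow_add hn0]
  gcongr
  nlinarith

theorem exp_five_le {X : ℝ} (hX : 1 ≤ X) :
    5 * Real.exp (Real.pi * (X / 2 + 9 / 8) ^ 2 + 2 * Real.pi * (X / 2 + 9 / 8)) ≤
      Real.exp ((X + 4) ^ 2) := by
  have he := Real.exp_one_gt_d9
  have h5 : (5 : ℝ) ≤ Real.exp 2 := by
    rw [show (2 : ℝ) = (2 : ℕ) * 1 by norm_num, Real.exp_nat_mul]
    calc (5 : ℝ) ≤ 2.7 ^ 2 := by norm_num
      _ ≤ _ := by gcongr; linarith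
  calc _ ≤ Real.exp 2 *
        Real.exp (Real.pi * (X / 2 + 9 / 8) ^ 2 + 2 * Real.pi * (X / 2 + 9 / 8)) := by gcongr
    _ ≤ _ := by
      rw [← Real.exp_add]
      apply Real.exp_le_exp.2
      have hpi := Real.pi_lt_d2
      have : Real.pi * ((X / 2 + 9 / 8) ^ 2 + 2 * (X / 2 + 9 / 8)) ≤
        3.15 * ((X / 2 + 9 / 8) ^ 2 + 2 * (X / 2 + 9 / 8)) := by gcongr
      nlinarith

theorem union_bound_numeric (hn : 40 ≤ n) {a : ℝ} (ha : (n : ℝ) ^ 2 ≤ a) :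
    (16 * (n : ℝ) + 1) ^ n * Real.exp (-a) ≤ 2⁻¹ ^ n := by
  have hn' : (40 : ℝ) ≤ n := by exact_mod_cast hn
  have h3 := Real.pow_div_factorial_le_exp (n : ℝ) (by positivity) 3
  have h4 : 2 * (16 * (n : ℝ) + 1) ≤ Real.exp n := by
    refine le_trans ?_ h3
    rw [show ((Nat.factorial 3 : ℕ) : ℝ) = 6 by norm_num [Nat.factorial], le_div_iff₀ (by norm_num)]
    nlinarith [mul_nonneg (by linarith : (0 : ℝ) ≤ n) (sq_nonneg (n : ℝ)), sq_nonneg ((n : ℝ) - 40)]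
  have h5 : (16 * (n : ℝ) + 1) * Real.exp (-n) ≤ 2⁻¹ := by
    rw [Real.exp_neg, ← div_eq_mul_inv, div_le_iff₀ (Real.exp_pos _)]
    linarith
  calc _ ≤ (16 * (n : ℝ) + 1) ^ n * Real.exp (-(n : ℝ) ^ 2) := by gcongr
    _ = ((16 * (n : ℝ) + 1) * Real.exp (-n)) ^ n := by
      rw [mul_pow, ← Real.exp_nat_mul]; congr 2; ring
    _ ≤ _ := by gcongr

end Numeric

/-! ### Every long vector is reduced by some sample -/

section Cover

variable {n : ℕ} {α : ℝ}

theorem measure_pi_uncovered_le (L : Submodule ℤ (E n)) [DiscreteTopology L] [IsZLattice ℝ L]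
    (hn : 40 ≤ n) (h1 : 2 / Real.logb 2 n ≤ α) (h2 : α ≤ 1 / 2) :
    (Measure.pi fun _ : Fin (sampleCount n α) => discreteGaussian L (eta L))
      {y | ∃ u : E n, ‖u‖ = 1 ∧
        ∀ i, y i ∉ capSet L u ((n : ℝ) ^ (1 / 2 - α) / 2 * eta L) ((n - 4) * eta L ^ 2)} ≤
      (2 : ℝ≥0∞)⁻¹ ^ n := by
  have hn0 : 0 < n := by omega
  have hn' : (40 : ℝ) ≤ n := by exact_mod_cast hn
  have hs := eta_pos L hn0
  have hX1 := one_le_rpow_half_sub hn h2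
  have hX2 := rpow_half_sub_sq_le hn h1
  set X := (n : ℝ) ^ (1 / 2 - α) with hX
  set τ := X / 2 + 9 / 8 with hτ
  set p := Real.exp (-(Real.pi * τ ^ 2 + 2 * Real.pi * τ)) / 5 with hp
  have hR : n / 2 + 2 * τ + τ ^ 2 ≤ (n : ℝ) - 4 := by
    rw [hτ]; nlinarith [sq_nonneg (X - 1)]
  have hprob : ∀ u : E n, ‖u‖ = 1 → ENNReal.ofReal p ≤ discreteGaussian L (eta L)
      (capSet L u ((X / 2 + 1 / 8) * eta L) (((n : ℝ) - 4) * eta L ^ 2)) := by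
    intro u hu
    have hc := cap_mass_ge L hn hu (τ := τ) (by positivity)
    have hpos := rhoLattice_pos L hs.ne'
    calc ENNReal.ofReal p ≤ discreteGaussian L (eta L)
          (capSet L u ((τ - 1) * eta L) ((n / 2 + 2 * τ + τ ^ 2) * eta L ^ 2)) := by
          rw [discreteGaussian_apply L hs.ne']
          refine ENNReal.ofReal_le_ofReal ?_
          rw [le_div_iff₀ hpos]
          exact hc
      _ ≤ _ := by
        refine measure_mono fun y hy => ⟨?_, hy.2.trans (by gcongr)⟩
        convert hy.1 using 2
        rw [hτ]; ring
  refine (measure_uncovered_le L hn0 hs (by linarith) hprob _).trans ?_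
  have hN : (n : ℝ) ^ 2 ≤ sampleCount n α * p := by
    have hle : nAlpha n α ≤ sampleCount n α := Nat.le_ceil _
    have h5 := exp_five_le hX1
    rw [← hτ] at h5
    calc (n : ℝ) ^ 2 ≤ nAlpha n α * p := by
          rw [nAlpha, ← hX, hp, Real.exp_neg, mul_assoc]
          refine le_mul_of_one_le_right (by positivity) ?_
          rw [mul_div_assoc', le_div_iff₀ (by norm_num), ← div_eq_mul_inv,
            le_div_iff₀ (Real.exp_pos _)]
          linarith
      _ ≤ _ := by gcongr
  refine (ENNReal.ofReal_le_ofReal (union_bound_numeric hn hN)).trans ?_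
  rw [ENNReal.ofReal_pow (by norm_num), ENNReal.ofReal_inv_of_pos (by norm_num)]
  simp

/-- A lattice vector in the cap around the direction of `t` reduces `t`, if `t` is long enough. -/
theorem exists_step_of_mem_cap (hn : 40 ≤ n) (h2 : α ≤ 1 / 2) {s : ℝ} (hs : 0 < s) {t y : E n}
    (ht : (n : ℝ) ^ (1 / 2 + α) * s ≤ ‖t‖)
    (hy1 : (n : ℝ) ^ (1 / 2 - α) / 2 * s ≤ inner ℝ (‖t‖⁻¹ • t) y)
    (hy2 : ‖y‖ ^ 2 ≤ (n - 4) * s ^ 2) :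
    ∃ k : ℤ, ‖t - (k : ℝ) • y‖ ^ 2 ≤ (1 - 1 / (n : ℝ) ^ 2) * ‖t‖ ^ 2 := by
  have hn' : (40 : ℝ) ≤ n := by exact_mod_cast hn
  have hn0 : (0 : ℝ) < n := by linarith
  set X := (n : ℝ) ^ (1 / 2 - α)
  set T₀ := (n : ℝ) ^ (1 / 2 + α)
  have hX : 0 < X := Real.rpow_pos_of_pos hn0 _
  have hT₀ : 0 < T₀ := Real.rpow_pos_of_pos hn0 _
  have hTX : T₀ * X = n := by
    rw [← Real.rpow_add hn0, show 1 / 2 + α + (1 / 2 - α) = 1 by ring, Real.rpow_one]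
  have hT₀n : T₀ ≤ n := by
    calc T₀ ≤ (n : ℝ) ^ (1 : ℝ) :=
          Real.rpow_le_rpow_of_exponent_le (by linarith) (by linarith)
      _ = n := Real.rpow_one _
  have htpos : 0 < ‖t‖ := lt_of_lt_of_le (by positivity) ht
  have hd : 0 < T₀ * s := by positivity
  have hk1 : 1 ≤ ⌊‖t‖ / (T₀ * s)⌋ := by
    rw [Int.le_floor]; push_cast; rwa [le_div_iff₀ hd, one_mul]
  have hk2 := Int.floor_le (‖t‖ / (T₀ * s))
  have hk3 := Int.lt_floor_add_one (‖t‖ / (T₀ * s))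
  set k := ⌊‖t‖ / (T₀ * s)⌋
  refine ⟨k, ?_⟩
  have hk1' : (1 : ℝ) ≤ k := by exact_mod_cast hk1
  rw [le_div_iff₀ hd] at hk2
  rw [div_lt_iff₀ hd] at hk3
  rw [inner_smul_left, conj_trivial, inv_mul_eq_div, le_div_iff₀ htpos] at hy1
  rw [@norm_sub_sq_real, inner_smul_right, norm_smul, mul_pow, Real.norm_eq_abs, sq_abs]
  have a1 : (k : ℝ) ^ 2 * ‖y‖ ^ 2 ≤ (k : ℝ) ^ 2 * ((n - 4) * s ^ 2) := by gcongr
  have a2 : (k : ℝ) * (X / 2 * s * ‖t‖) ≤ k * inner ℝ t y := by gcongr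
  have a3 : (k : ℝ) * (X / 2 * s * (k * (T₀ * s))) ≤ (k : ℝ) * (X / 2 * s * ‖t‖) := by gcongr
  have a4 : ‖t‖ ≤ 2 * k * (n * s) := by
    calc ‖t‖ ≤ (k + 1) * (T₀ * s) := hk3.le
      _ ≤ (2 * k) * (n * s) := by gcongr; linarith
  have a5 : 1 / (n : ℝ) ^ 2 * ‖t‖ ^ 2 ≤ 4 * k ^ 2 * s ^ 2 := by
    rw [one_div, inv_mul_le_iff₀ (by positivity)]
    calc ‖t‖ ^ 2 ≤ (2 * k * (n * s)) ^ 2 := by gcongr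
      _ = _ := by ring
  have a6 : (k : ℝ) * (X / 2 * s * (k * (T₀ * s))) = k ^ 2 * s ^ 2 * n / 2 := by
    rw [← hTX]; ring
  nlinarith

/-- If every vector longer than `d` can be reduced, then every output is within distance `d`. -/
theorem isOutput_close {N : ℕ} {L : Submodule ℤ (E n)} (hn : 40 ≤ n) (hs : 0 < eta L) {d : ℝ}
    (hd : eta L ≤ d) {y : Fin N → E n} (hy : ∀ i, y i ∈ L)
    (hstep : ∀ t : E n, d ≤ ‖t‖ → ∃ u, IsStep y t u) {t z : E n} (hz : IsOutput L y t z) :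
    z ∈ L ∧ ‖z - t‖ ≤ d := by
  obtain ⟨j, τ, hτL, hτ0, hτ, hend, rfl⟩ := hz
  have hmem : ∀ m ≤ j, τ m - t ∈ L := by
    intro m hm
    induction m with
    | zero => exact hτL
    | succ m ih =>
      obtain ⟨i, k, hk, -⟩ := hτ m hm
      rw [hk, show τ m - (k : ℝ) • y i - t = (τ m - t) - k • y i by
        rw [Int.cast_smul_eq_zsmul]; abel]
      exact L.sub_mem (ih (by omega)) (L.smul_mem _ (hy i))
  refine ⟨by rw [← neg_sub]; exact L.neg_mem (hmem j le_rfl), ?_⟩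
  rw [sub_sub_cancel_left, norm_neg]
  rcases hend with hj | ⟨-, hno⟩
  · have hn' : (40 : ℝ) ≤ n := by exact_mod_cast hn
    have hq : 0 ≤ 1 - 1 / (n : ℝ) ^ 2 := by
      rw [sub_nonneg, div_le_one (by positivity)]; nlinarith
    have hdecay : ∀ m ≤ j, ‖τ m‖ ^ 2 ≤ (1 - 1 / (n : ℝ) ^ 2) ^ m * ‖τ 0‖ ^ 2 := by
      intro m hm
      induction m with
      | zero => simp
      | succ m ih =>
        obtain ⟨i, k, -, hk⟩ := hτ m hm
        calc _ ≤ (1 - 1 / (n : ℝ) ^ 2) * ‖τ m‖ ^ 2 := hk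
          _ ≤ (1 - 1 / (n : ℝ) ^ 2) * ((1 - 1 / (n : ℝ) ^ 2) ^ m * ‖τ 0‖ ^ 2) := by
            gcongr; exact ih (by omega)
          _ = _ := by ring
    have h100 : (1 - 1 / (n : ℝ) ^ 2) ^ j ≤ Real.exp (-1) ^ (2 * n) := by
      calc (1 - 1 / (n : ℝ) ^ 2) ^ j ≤ Real.exp (-(1 / (n : ℝ) ^ 2)) ^ j := by
            gcongr; exact Real.one_sub_le_exp_neg _
        _ = Real.exp (-(100 * n)) := by
          rw [← Real.exp_nat_mul, hj]
          congr 1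
          push_cast
          field_simp
        _ ≤ _ := by
          rw [← Real.exp_nat_mul]
          apply Real.exp_le_exp.2
          push_cast
          linarith
    have he : Real.exp (-1) * 2 ≤ 1 := by
      have := Real.exp_one_gt_d9
      rw [Real.exp_neg, inv_mul_le_iff₀ (Real.exp_pos _)]
      linarith
    have hfin : ‖τ j‖ ^ 2 ≤ eta L ^ 2 := by
      calc ‖τ j‖ ^ 2 ≤ Real.exp (-1) ^ (2 * n) * (2 ^ n * eta L) ^ 2 := by
            refine (hdecay j le_rfl).trans ?_
            gcongr
        _ = (Real.exp (-1) * 2) ^ (2 * n) * eta L ^ 2 := by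
          rw [mul_pow (Real.exp (-1)), mul_pow _ (eta L), ← pow_mul 2, mul_comm n 2, mul_assoc]
        _ ≤ 1 * eta L ^ 2 := by
          gcongr
          exact pow_le_one₀ (by positivity) he
        _ = _ := one_mul _
    exact (abs_le_of_sq_le_sq' hfin hs.le).2.trans hd
  · by_contra! hlt
    obtain ⟨u, hu⟩ := hstep _ hlt.le
    exact hno u hu

theorem measure_isOutput_close_ge (L : Submodule ℤ (E n)) [DiscreteTopology L] [IsZLattice ℝ L]
    (hn : 40 ≤ n) (h1 : 2 / Real.logb 2 n ≤ α) (h2 : α ≤ 1 / 2) :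
    1 - (2 : ℝ≥0∞)⁻¹ ^ n ≤
      (Measure.pi fun _ : Fin (sampleCount n α) => discreteGaussian L (eta L))
        {y | ∀ t z : E n, IsOutput L (fun i => (y i : E n)) t z →
          z ∈ L ∧ ‖z - t‖ ≤ (n : ℝ) ^ (1 / 2 + α) * eta L} := by
  have hn0 : 0 < n := by omega
  have hn' : (40 : ℝ) ≤ n := by exact_mod_cast hn
  have hs := eta_pos L hn0
  have := isProbabilityMeasure_discreteGaussian L hs.ne'
  set P := Measure.pi fun _ : Fin (sampleCount n α) => discreteGaussian L (eta L)
  set bad : Set (Fin (sampleCount n α) → L) := {y | ∃ u : E n, ‖u‖ = 1 ∧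
        ∀ i, y i ∉ capSet L u ((n : ℝ) ^ (1 / 2 - α) / 2 * eta L) ((n - 4) * eta L ^ 2)}
  have hbad : P bad ≤ (2 : ℝ≥0∞)⁻¹ ^ n := measure_pi_uncovered_le L hn h1 h2
  have hα : 0 ≤ α := by
    refine le_trans (div_nonneg (by norm_num) ?_) h1
    exact Real.logb_nonneg (by norm_num) (by linarith)
  have hT₀ : 1 ≤ (n : ℝ) ^ (1 / 2 + α) := Real.one_le_rpow (by linarith) (by linarith)
  calc 1 - (2 : ℝ≥0∞)⁻¹ ^ n ≤ 1 - P bad := by gcongr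
    _ = P badᶜ := (prob_compl_eq_one_sub bad.to_countable.measurableSet).symm
    _ ≤ _ := by
      refine measure_mono fun y hy t z hz => ?_
      refine isOutput_close hn hs (le_mul_of_one_le_left hs.le hT₀) (fun i => (y i).2)
        (fun t ht => ?_) hz
      have htpos : 0 < ‖t‖ := lt_of_lt_of_le (by positivity) ht
      have hu : ‖‖t‖⁻¹ • t‖ = 1 := by
        rw [norm_smul, norm_inv, norm_norm, inv_mul_cancel₀ htpos.ne']
      obtain ⟨i, hi⟩ : ∃ i, y i ∈ capSet L (‖t‖⁻¹ • t) ((n : ℝ) ^ (1 / 2 - α) / 2 * eta L)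
          ((n - 4) * eta L ^ 2) := by
        by_contra! hno
        exact hy ⟨_, hu, hno⟩
      obtain ⟨k, hk⟩ := exists_step_of_mem_cap hn h2 hs ht hi.1 hi.2
      exact ⟨_, i, k, rfl, hk⟩

end Cover

end GDD

namespace GDD

/-! ### Values and step counts of the elementary programs -/

section Programs

variable {n : ℕ}

namespace Timed

theorem val_bind {A B : Type} (x : Timed A) (f : A → Timed B) : (x >>= f).val = (f x.val).val := rfl

theorem steps_bind {A B : Type} (x : Timed A) (f : A → Timed B) :
    (x >>= f).steps = x.steps + (f x.val).steps := rfl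

theorem val_pure {A : Type} (a : A) : (pure a : Timed A).val = a := rfl

theorem steps_pure {A : Type} (a : A) : (pure a : Timed A).steps = 0 := rfl

end Timed

theorem dot_val (u v : E n) : (dot u v).val = inner ℝ u v := by
  simp only [dot, Timed.sum, Timed.val_bind, Timed.read, Timed.mul, PiLp.inner_apply]
  exact Finset.sum_congr rfl fun i _ => by simp [mul_comm]

theorem dot_steps (u v : E n) : (dot u v).steps = 5 * n := by
  simp [dot, Timed.sum, Timed.steps_bind, Timed.read, Timed.mul, mul_comm]

theorem coeff_val (t y : E n) : (coeff t y).val = inner ℝ t y / ‖y‖ ^ 2 := by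
  simp only [coeff, Timed.val_bind, dot_val, Timed.le, real_inner_self_eq_norm_sq]
  by_cases h : ‖y‖ ^ 2 ≤ 0
  · have : ‖y‖ ^ 2 = 0 := le_antisymm h (sq_nonneg _)
    simp [this, Timed.val_pure]
  · simp only [h, decide_false, Bool.false_eq_true, if_false, Timed.div]

theorem coeff_steps_le (t y : E n) : (coeff t y).steps ≤ 10 * n + 2 := by
  simp only [coeff, Timed.steps_bind, dot_steps, Timed.le]
  split_ifs <;> simp only [Timed.steps_pure, Timed.div] <;> omega

theorem subMul_val (t : E n) (c : ℝ) (y : E n) : (subMul t c y).val = t - c • y := by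
  ext i
  simp [subMul, Timed.tabulate, Timed.val_bind, Timed.read, Timed.mul, Timed.sub]

theorem subMul_steps (t : E n) (c : ℝ) (y : E n) : (subMul t c y).steps = 6 * n := by
  simp [subMul, Timed.tabulate, Timed.steps_bind, Timed.read, Timed.mul, Timed.sub, mul_comm]

theorem orthogonalize_val (b : E n) (l : List (E n × E n)) (v : E n) :
    (orthogonalize b l v).val =
      v - (l.map fun p => (inner ℝ b p.2 / ‖p.2‖ ^ 2) • p.2).sum := by
  induction l generalizing v with
  | nil => simp [orthogonalize, Timed.val_pure]
  | cons p l ih =>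
    simp only [orthogonalize, Timed.val_bind, ih, coeff_val, subMul_val, List.map_cons,
      List.sum_cons]
    abel

theorem orthogonalize_steps_le (b : E n) (l : List (E n × E n)) (v : E n) :
    (orthogonalize b l v).steps ≤ l.length * (16 * n + 3) := by
  induction l generalizing v with
  | nil => simp [orthogonalize, Timed.steps_pure]
  | cons p l ih =>
    simp only [orthogonalize, Timed.steps_bind, subMul_steps, Timed.tick, List.length_cons]
    have h1 := coeff_steps_le b p.2
    have h2 := ih (subMul v (coeff b p.2).val p.2).val
    rw [add_mul]
    omega

theorem gramSchmidtPairs_length (bs : List (E n)) (acc : List (E n × E n)) :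
    (gramSchmidtPairs bs acc).val.length = bs.length + acc.length := by
  induction bs generalizing acc with
  | nil => simp [gramSchmidtPairs, Timed.val_pure]
  | cons b bs ih =>
    simp only [gramSchmidtPairs, Timed.val_bind, ih, List.length_cons]
    omega

theorem gramSchmidtPairs_steps_le (bs : List (E n)) (acc : List (E n × E n)) :
    (gramSchmidtPairs bs acc).steps ≤
      bs.length * (1 + (bs.length + acc.length) * (16 * n + 3)) := by
  induction bs generalizing acc with
  | nil => simp [gramSchmidtPairs, Timed.steps_pure]
  | cons b bs ih =>
    simp only [gramSchmidtPairs, Timed.steps_bind, Timed.tick, List.length_cons]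
    have h1 := orthogonalize_steps_le b acc b
    have h2 := ih ((b, (orthogonalize b acc b).val) :: acc)
    simp only [List.length_cons] at h2
    have h3 : acc.length * (16 * n + 3) ≤ (bs.length + 1 + acc.length) * (16 * n + 3) := by
      gcongr; omega
    rw [show bs.length + (acc.length + 1) = bs.length + 1 + acc.length by omega] at h2
    rw [add_mul bs.length 1 (1 + _), one_mul]
    omega

theorem nearestPlane_steps_le (l : List (E n × E n)) (t : E n) :
    (nearestPlane l t).steps ≤ l.length * (16 * n + 4) := by
  induction l generalizing t with
  | nil => simp [nearestPlane, Timed.steps_pure]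
  | cons p l ih =>
    simp only [nearestPlane, Timed.steps_bind, Timed.tick, subMul_steps, Timed.nearest,
      List.length_cons]
    have h1 := coeff_steps_le t p.2
    have h2 := ih (subMul t (round (coeff t p.2).val : ℝ) p.1).val
    rw [add_mul]
    omega

theorem babai_steps_le (bs : List (E n)) (t : E n) :
    (babai bs t).steps ≤
      bs.length * (1 + bs.length * (16 * n + 3)) + bs.length * (16 * n + 4) := by
  simp only [babai, Timed.steps_bind]
  have h1 := gramSchmidtPairs_steps_le bs []
  have h2 := nearestPlane_steps_le (gramSchmidtPairs bs []).val t
  rw [gramSchmidtPairs_length] at h2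
  simp only [List.length_nil, add_zero] at h1 h2
  omega

/-- The integer nearest to `⟪t, y⟫ / ‖y‖²` minimizes the length of `t - k y`. -/
theorem norm_sub_round_smul_le (t y : E n) (k : ℤ) :
    ‖t - (round (inner ℝ t y / ‖y‖ ^ 2) : ℝ) • y‖ ^ 2 ≤ ‖t - (k : ℝ) • y‖ ^ 2 := by
  rcases eq_or_ne y 0 with rfl | hy
  · simp
  have hpos : ‖y‖ ^ 2 ≠ 0 := pow_ne_zero 2 (norm_ne_zero_iff.2 hy)
  set x := inner ℝ t y / ‖y‖ ^ 2 with hx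
  have hxy : inner ℝ t y = x * ‖y‖ ^ 2 := by rw [hx, div_mul_cancel₀ _ hpos]
  have key : ∀ c : ℝ, ‖t - c • y‖ ^ 2 = ‖t‖ ^ 2 + ‖y‖ ^ 2 * ((x - c) ^ 2 - x ^ 2) := by
    intro c
    rw [@norm_sub_sq_real, inner_smul_right, hxy, norm_smul, mul_pow, Real.norm_eq_abs, sq_abs]
    ring
  rw [key, key]
  have := sq_le_sq.2 (round_le x k)
  gcongr

theorem search_none {t : E n} {ys : List (E n)} (h : (search t ys).val = none) :
    ∀ y ∈ ys, ∀ k : ℤ, ¬ ‖t - (k : ℝ) • y‖ ^ 2 ≤ (1 - 1 / (n : ℝ) ^ 2) * ‖t‖ ^ 2 := by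
  induction ys with
  | nil => simp
  | cons y l ih =>
    simp only [search, Timed.val_bind, Timed.nearest, Timed.mul, Timed.div, Timed.sub, Timed.le,
      dot_val, subMul_val, coeff_val, real_inner_self_eq_norm_sq, ← sq, decide_eq_true_eq] at h
    split_ifs at h with hc
    intro z hz k hk
    rcases List.mem_cons.1 hz with rfl | hz
    · exact hc ((norm_sub_round_smul_le t z k).trans hk)
    · exact ih h z hz k hk

theorem search_some {t u : E n} {ys : List (E n)} (h : (search t ys).val = some u) :
    ∃ y ∈ ys, ∃ k : ℤ, u = t - (k : ℝ) • y ∧ ‖u‖ ^ 2 ≤ (1 - 1 / (n : ℝ) ^ 2) * ‖t‖ ^ 2 := by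
  induction ys with
  | nil => simp [search, Timed.val_pure] at h
  | cons y l ih =>
    simp only [search, Timed.val_bind, Timed.nearest, Timed.mul, Timed.div, Timed.sub, Timed.le,
      dot_val, subMul_val, coeff_val, real_inner_self_eq_norm_sq, ← sq, decide_eq_true_eq] at h
    split_ifs at h with hc
    · simp only [Timed.val_pure, Option.some.injEq] at h
      exact ⟨y, List.mem_cons_self, _, h.symm, h ▸ hc⟩
    · obtain ⟨z, hz, hr⟩ := ih h
      exact ⟨z, List.mem_cons_of_mem _ hz, hr⟩

theorem search_steps_le (t : E n) (ys : List (E n)) :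
    (search t ys).steps ≤ ys.length * (26 * n + 9) := by
  induction ys with
  | nil => simp [search, Timed.steps_pure]
  | cons y l ih =>
    simp only [search, Timed.steps_bind, Timed.nearest, Timed.mul, Timed.div, Timed.sub, Timed.le,
      dot_steps, subMul_steps, Timed.tick, List.length_cons]
    have h1 := coeff_steps_le t y
    rw [add_mul]
    split_ifs
    · simp only [Timed.steps_pure]; omega
    · omega

theorem reduce_steps_le (ys : List (E n)) (J : ℕ) (t : E n) :
    (reduce ys J t).steps ≤ J * (1 + ys.length * (26 * n + 9)) := by
  induction J generalizing t with
  | zero => simp [reduce, Timed.steps_pure]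
  | succ J ih =>
    simp only [reduce, Timed.steps_bind, Timed.tick]
    have h1 := search_steps_le t ys
    rw [add_mul]
    split
    · simp only [Timed.steps_pure]; omega
    · rename_i u _
      have := ih u
      omega

/-- The reduction loop follows a sequence of steps, which ends when the rounds are used up or no
further step is possible. -/
theorem reduce_trace {N : ℕ} (y : Fin N → E n) (J : ℕ) (t : E n) :
    ∃ (j : ℕ) (τ : ℕ → E n), τ 0 = t ∧ (∀ m < j, IsStep y (τ m) (τ (m + 1))) ∧
      (j = J ∨ (j < J ∧ ∀ u, ¬ IsStep y (τ j) u)) ∧ (reduce (List.ofFn y) J t).val = τ j := by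
  induction J generalizing t with
  | zero => exact ⟨0, fun _ => t, rfl, by simp, Or.inl rfl, rfl⟩
  | succ J ih =>
    simp only [reduce, Timed.val_bind]
    rcases hsr : (search t (List.ofFn y)).val with _ | u
    · refine ⟨0, fun _ => t, rfl, by simp, Or.inr ⟨J.succ_pos, ?_⟩, rfl⟩
      rintro u ⟨i, k, rfl, hk⟩
      exact search_none hsr (y i) (List.mem_ofFn.2 ⟨i, rfl⟩) k hk
    · obtain ⟨z, hz, k, hu, hle⟩ := search_some hsr
      obtain ⟨i, rfl⟩ := List.mem_ofFn.1 hz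
      obtain ⟨j, τ, h0, hstep, hend, hval⟩ := ih u
      refine ⟨j + 1, fun m => Nat.casesOn m t τ, rfl, fun m hm => ?_, ?_, hval⟩
      · cases m with
        | zero => exact ⟨i, k, by simpa [h0] using hu, by simpa [h0] using hle⟩
        | succ m => exact hstep m (by omega)
      · rcases hend with rfl | ⟨hj, hno⟩
        · exact Or.inl rfl
        · exact Or.inr ⟨by omega, hno⟩

theorem query_steps_le (bs ys : List (E n)) (t : E n) :
    (query bs ys t).steps ≤
      bs.length * (1 + bs.length * (16 * n + 3)) + bs.length * (16 * n + 4) +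
        100 * n ^ 3 * (1 + ys.length * (26 * n + 9)) + 6 * n := by
  simp only [query, Timed.steps_bind, subMul_steps]
  have h1 := babai_steps_le bs t
  have h2 := reduce_steps_le ys (100 * n ^ 3) (babai bs t).val
  omega

end Programs

end GDD

namespace GDD

open InnerProductSpace Submodule

/-! ### Gram-Schmidt vectors under unitriangular changes and swaps -/

section GramSchmidt

variable {n m : ℕ}

theorem gramSchmidt_sub_mem (v : Fin m → E n) (i : Fin m) :
    gramSchmidt ℝ v i - v i ∈ span ℝ (v '' Set.Iio i) := by
  rw [gramSchmidt_def, sub_sub_cancel_left, ← span_gramSchmidt_Iio ℝ v i]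
  refine neg_mem (sum_mem fun j hj => ?_)
  have h := Submodule.starProjection_apply_mem (span ℝ {gramSchmidt ℝ v j}) (v i)
  refine span_mono ?_ h
  simpa using ⟨j, Finset.mem_Iio.1 hj, rfl⟩

theorem inner_eq_zero_of_mem_span {S : Set (E n)} {w x : E n} (hw : w ∈ span ℝ S)
    (hx : ∀ y ∈ S, inner ℝ y x = 0) : inner ℝ w x = 0 := by
  induction hw using span_induction with
  | mem y hy => exact hx y hy
  | zero => simp
  | add y z _ _ hy hz => rw [inner_add_left, hy, hz, add_zero]
  | smul a y _ hy => rw [inner_smul_left, hy, mul_zero]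

theorem inner_gramSchmidt_of_mem_span (v : Fin m → E n) (i : Fin m) {w : E n}
    (hw : w ∈ span ℝ (v '' Set.Iio i)) : inner ℝ w (gramSchmidt ℝ v i) = 0 := by
  refine inner_eq_zero_of_mem_span hw ?_
  rintro _ ⟨j, hj, rfl⟩
  rw [real_inner_comm]
  exact gramSchmidt_inv_triangular ℝ v hj

theorem inner_self_gramSchmidt (v : Fin m → E n) (i : Fin m) :
    inner ℝ (v i) (gramSchmidt ℝ v i) = ‖gramSchmidt ℝ v i‖ ^ 2 := by
  have h := inner_gramSchmidt_of_mem_span v i (gramSchmidt_sub_mem v i)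
  rw [inner_sub_left, real_inner_self_eq_norm_sq] at h
  linarith

theorem eq_gramSchmidt (v : Fin m → E n) (i : Fin m) {x : E n}
    (hx : x - v i ∈ span ℝ (v '' Set.Iio i)) (ho : ∀ j < i, inner ℝ (v j) x = 0) :
    x = gramSchmidt ℝ v i := by
  have hd : x - gramSchmidt ℝ v i ∈ span ℝ (v '' Set.Iio i) := by
    have := sub_mem hx (gramSchmidt_sub_mem v i)
    rwa [sub_sub_sub_cancel_right] at this
  have h1 := inner_gramSchmidt_of_mem_span v i hd
  have h2 : inner ℝ (x - gramSchmidt ℝ v i) x = 0 := by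
    refine inner_eq_zero_of_mem_span hd ?_
    rintro _ ⟨j, hj, rfl⟩
    exact ho j hj
  rw [← sub_eq_zero, ← inner_self_eq_zero (𝕜 := ℝ), inner_sub_right, h1, h2, sub_zero]

theorem norm_gramSchmidt_le (v : Fin m → E n) (i : Fin m) {x : E n}
    (hx : x - v i ∈ span ℝ (v '' Set.Iio i)) : ‖gramSchmidt ℝ v i‖ ≤ ‖x‖ := by
  have hd : x - gramSchmidt ℝ v i ∈ span ℝ (v '' Set.Iio i) := by
    have := sub_mem hx (gramSchmidt_sub_mem v i)
    rwa [sub_sub_sub_cancel_right] at this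
  have h1 := inner_gramSchmidt_of_mem_span v i hd
  have h2 : ‖x‖ ^ 2 = ‖x - gramSchmidt ℝ v i‖ ^ 2 + ‖gramSchmidt ℝ v i‖ ^ 2 := by
    conv_lhs => rw [← sub_add_cancel x (gramSchmidt ℝ v i)]
    rw [@norm_add_sq_real, h1]
    ring
  exact (abs_le_of_sq_le_sq' (by nlinarith [sq_nonneg ‖x - gramSchmidt ℝ v i‖])
    (norm_nonneg x)).2

theorem gramSchmidt_congr (v v' : Fin m → E n) (i : Fin m)
    (hs : span ℝ (v' '' Set.Iio i) = span ℝ (v '' Set.Iio i))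
    (hi : v' i - v i ∈ span ℝ (v '' Set.Iio i)) : gramSchmidt ℝ v' i = gramSchmidt ℝ v i := by
  refine eq_gramSchmidt v i ?_ fun j hj => ?_
  · have := add_mem (hs ▸ gramSchmidt_sub_mem v' i) hi
    rwa [sub_add_sub_cancel] at this
  · refine inner_gramSchmidt_of_mem_span v' i ?_
    rw [hs]
    exact subset_span ⟨j, hj, rfl⟩

section Unitriangular

variable {R : Type*} [Ring R] {M : Type*} [AddCommGroup M] [Module R M] {v v' : Fin m → M}

theorem mem_span_of_unitriangular (h : ∀ i, v' i - v i ∈ span R (v '' Set.Iio i)) (i : Fin m) :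
    v i ∈ span R (v' '' Set.Iic i) := by
  induction i using WellFoundedLT.induction with
  | ind i ih =>
    have h1 : v i - v' i ∈ span R (v' '' Set.Iic i) := by
      rw [← neg_sub]
      refine neg_mem (span_le.2 ?_ (h i))
      rintro _ ⟨k, hk, rfl⟩
      exact span_mono (Set.image_mono (Set.Iic_subset_Iic.2 (le_of_lt hk))) (ih k hk)
    simpa using add_mem h1 (subset_span ⟨i, Set.self_mem_Iic, rfl⟩)

theorem span_Iio_of_unitriangular (h : ∀ i, v' i - v i ∈ span R (v '' Set.Iio i)) (i : Fin m) :
    span R (v' '' Set.Iio i) = span R (v '' Set.Iio i) := by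
  apply le_antisymm
  · rw [span_le]
    rintro _ ⟨k, hk, rfl⟩
    have h1 : v' k - v k ∈ span R (v '' Set.Iio i) :=
      span_mono (Set.image_mono (Set.Iio_subset_Iio (le_of_lt hk))) (h k)
    simpa using add_mem h1 (subset_span ⟨k, hk, rfl⟩)
  · rw [span_le]
    rintro _ ⟨k, hk, rfl⟩
    exact span_mono (Set.image_mono (Set.Iic_subset_Iio.2 hk)) (mem_span_of_unitriangular h k)

theorem span_range_of_unitriangular (h : ∀ i, v' i - v i ∈ span R (v '' Set.Iio i)) :
    span R (Set.range v') = span R (Set.range v) := by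
  apply le_antisymm
  · rw [span_le]
    rintro _ ⟨k, rfl⟩
    have h1 : v' k - v k ∈ span R (Set.range v) := span_mono (Set.image_subset_range _ _) (h k)
    simpa using add_mem h1 (subset_span ⟨k, rfl⟩)
  · rw [span_le]
    rintro _ ⟨k, rfl⟩
    exact span_mono (Set.image_subset_range _ _) (mem_span_of_unitriangular h k)

end Unitriangular

theorem span_int_le_real (S : Set (E n)) {x : E n} (hx : x ∈ span ℤ S) : x ∈ span ℝ S :=
  span_subset_span ℤ ℝ S hx

theorem gramSchmidt_of_unitriangular {v v' : Fin m → E n}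
    (h : ∀ i, v' i - v i ∈ span ℤ (v '' Set.Iio i)) : gramSchmidt ℝ v' = gramSchmidt ℝ v := by
  have h' : ∀ i, v' i - v i ∈ span ℝ (v '' Set.Iio i) := fun i => span_int_le_real _ (h i)
  ext1 i
  exact gramSchmidt_congr v v' i (span_Iio_of_unitriangular h' i) (h' i)

/-- One nearest plane step bounds the coefficient along the current Gram-Schmidt vector, and adding
vectors of the preceding span preserves the bound. -/
theorem abs_coeff_nearest_le (v : Fin m → E n) (i : Fin m) (hg : gramSchmidt ℝ v i ≠ 0) {t t' : E n}
    (h : t' - (t - (round (inner ℝ t (gramSchmidt ℝ v i) / ‖gramSchmidt ℝ v i‖ ^ 2) : ℝ) • v i) ∈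
      span ℝ (v '' Set.Iio i)) :
    |inner ℝ t' (gramSchmidt ℝ v i) / ‖gramSchmidt ℝ v i‖ ^ 2| ≤ 1 / 2 := by
  have hgi : ‖gramSchmidt ℝ v i‖ ^ 2 ≠ 0 := pow_ne_zero 2 (norm_ne_zero_iff.2 hg)
  have h0 := inner_gramSchmidt_of_mem_span v i h
  rw [inner_sub_left, inner_sub_left, inner_smul_left, inner_self_gramSchmidt, conj_trivial,
    sub_eq_zero] at h0
  rw [h0, sub_div, mul_div_cancel_right₀ _ hgi]
  exact abs_sub_round _

/-- The vectors of a system, paired with their Gram-Schmidt vectors. -/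
noncomputable def gsPairs (v : Fin m → E n) : List (E n × E n) :=
  List.ofFn fun i => (v i, gramSchmidt ℝ v i)

@[simp]
theorem length_gsPairs (v : Fin m → E n) : (gsPairs v).length = m := by simp [gsPairs]

theorem take_succ_gsPairs (v : Fin m → E n) {k : ℕ} (hk : k < m) :
    ((gsPairs v).take (k + 1)).reverse =
      (v ⟨k, hk⟩, gramSchmidt ℝ v ⟨k, hk⟩) :: ((gsPairs v).take k).reverse := by
  rw [List.take_add_one, List.reverse_append, List.getElem?_eq_getElem (by simpa using hk)]
  simp [gsPairs]

theorem gramSchmidtPairs_val (v : Fin m → E n) :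
    (gramSchmidtPairs (List.ofFn v) []).val = (gsPairs v).reverse := by
  suffices ∀ d k, k + d = m →
      (gramSchmidtPairs ((List.ofFn v).drop k) ((gsPairs v).take k).reverse).val =
        (gsPairs v).reverse by simpa using this m 0 (by omega)
  intro d
  induction d with
  | zero =>
    intro k hk
    rw [List.drop_of_length_le (by simp; omega), List.take_of_length_le (by simp; omega)]
    rfl
  | succ d ih =>
    intro k hk
    have hkm : k < m := by omega
    rw [List.drop_eq_getElem_cons (by simpa using hkm)]
    simp only [gramSchmidtPairs, Timed.val_bind]
    rw [← ih (k + 1) (by omega), take_succ_gsPairs v hkm]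
    congr 3
    simp only [List.getElem_ofFn, Prod.mk.injEq, true_and]
    rw [orthogonalize_val, List.map_reverse, List.sum_reverse, List.map_take, gsPairs,
      List.map_ofFn, List.sum_take_ofFn]
    conv_rhs => rw [gramSchmidt_def]
    congr 1
    refine Finset.sum_congr (by ext; simp [Fin.lt_def]) fun j _ => ?_
    rw [starProjection_singleton, real_inner_comm]
    simp

/-- The nearest plane loop reduces a vector against the first `k` vectors of a system. -/
theorem nearestPlane_spec (v : Fin m → E n) (hg : ∀ i, gramSchmidt ℝ v i ≠ 0) (k : ℕ) (hk : k ≤ m)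
    (t : E n) :
    (nearestPlane ((gsPairs v).take k).reverse t).val - t ∈ span ℤ (v '' {j | (j : ℕ) < k}) ∧
      ∀ j : Fin m, (j : ℕ) < k →
        |inner ℝ (nearestPlane ((gsPairs v).take k).reverse t).val (gramSchmidt ℝ v j) /
          ‖gramSchmidt ℝ v j‖ ^ 2| ≤ 1 / 2 := by
  induction k generalizing t with
  | zero => exact ⟨by simp [nearestPlane, Timed.val_pure], fun j hj => absurd hj (by omega)⟩
  | succ k ih =>
    have hmono : span ℤ (v '' {j | (j : ℕ) < k}) ≤ span ℤ (v '' {j | (j : ℕ) < k + 1}) :=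
      span_mono (Set.image_mono fun j (hj : (j : ℕ) < k) => Nat.lt_succ_of_lt hj)
    have hset : {j : Fin m | (j : ℕ) < k} = Set.Iio ⟨k, hk⟩ := by
      ext j; simp [Fin.lt_def]
    rw [take_succ_gsPairs v hk]
    simp only [nearestPlane, Timed.val_bind, coeff_val, subMul_val, Timed.nearest]
    obtain ⟨ht', hred⟩ := ih (by omega) (t - (round (inner ℝ t (gramSchmidt ℝ v ⟨k, hk⟩) /
      ‖gramSchmidt ℝ v ⟨k, hk⟩‖ ^ 2) : ℝ) • v ⟨k, hk⟩)
    refine ⟨?_, fun j hj => ?_⟩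
    · have h2 : (round (inner ℝ t (gramSchmidt ℝ v ⟨k, hk⟩) /
          ‖gramSchmidt ℝ v ⟨k, hk⟩‖ ^ 2) : ℝ) • v ⟨k, hk⟩ ∈
            span ℤ (v '' {j | (j : ℕ) < k + 1}) := by
        rw [Int.cast_smul_eq_zsmul]
        exact smul_mem _ _ (subset_span ⟨⟨k, hk⟩, Nat.lt_succ_self k, rfl⟩)
      convert sub_mem (hmono ht') h2 using 1
      abel
    · rcases Nat.lt_succ_iff_lt_or_eq.1 hj with hj | hj
      · exact hred j hj
      · obtain rfl : j = ⟨k, hk⟩ := Fin.ext hj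
        rw [hset] at ht'
        exact abs_coeff_nearest_le v _ (hg _) (span_int_le_real _ ht')

theorem babai_spec (v : Fin m → E n) (hg : ∀ i, gramSchmidt ℝ v i ≠ 0) (t : E n) :
    (babai (List.ofFn v) t).val - t ∈ span ℤ (Set.range v) ∧
      ∀ j, |inner ℝ (babai (List.ofFn v) t).val (gramSchmidt ℝ v j) /
        ‖gramSchmidt ℝ v j‖ ^ 2| ≤ 1 / 2 := by
  have h := nearestPlane_spec v hg m le_rfl t
  rw [List.take_of_length_le (by simp), ← gramSchmidtPairs_val] at h
  exact ⟨span_mono (Set.image_subset_range _ _) h.1, fun j => h.2 j j.2⟩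

section Swap

variable (v : Fin m → E n) {i j : Fin m} (hij : (j : ℕ) = i + 1)
include hij

theorem swap_image_Iio_of_le {k : Fin m} (hk : k ≤ i) :
    (v ∘ Equiv.swap i j) '' Set.Iio k = v '' Set.Iio k := by
  refine Set.image_congr fun l hl => ?_
  have hl : l < k := hl
  have h1 : l ≠ i := (hl.trans_le hk).ne
  have h2 : l ≠ j := by rintro rfl; simp only [Fin.lt_def, Fin.le_def] at hl hk; omega
  simp [Equiv.swap_apply_of_ne_of_ne h1 h2]

theorem swap_image_Iio_of_gt {k : Fin m} (hk : j < k) :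
    (v ∘ Equiv.swap i j) '' Set.Iio k = v '' Set.Iio k := by
  have hik : i < k := by simp only [Fin.lt_def] at *; omega
  rw [Set.image_comp, Equiv.image_eq_preimage_symm, Equiv.symm_swap]
  congr 1
  ext l
  rcases eq_or_ne l i with rfl | hi
  · simp [hk, hik]
  rcases eq_or_ne l j with rfl | hj
  · simp [hk, hik]
  · simp [Equiv.swap_apply_of_ne_of_ne hi hj]

theorem gramSchmidt_swap_of_lt {k : Fin m} (hk : k < i) :
    gramSchmidt ℝ (v ∘ Equiv.swap i j) k = gramSchmidt ℝ v k := by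
  have h1 : k ≠ i := hk.ne
  have h2 : k ≠ j := by rintro rfl; simp only [Fin.lt_def] at hk; omega
  refine gramSchmidt_congr _ _ k (by rw [swap_image_Iio_of_le v hij hk.le]) ?_
  simp [Equiv.swap_apply_of_ne_of_ne h1 h2]

theorem gramSchmidt_swap_of_gt {k : Fin m} (hk : j < k) :
    gramSchmidt ℝ (v ∘ Equiv.swap i j) k = gramSchmidt ℝ v k := by
  have h2 : k ≠ j := hk.ne'
  have h1 : k ≠ i := by rintro rfl; simp only [Fin.lt_def] at hk; omega
  refine gramSchmidt_congr _ _ k (by rw [swap_image_Iio_of_gt v hij hk]) ?_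
  simp [Equiv.swap_apply_of_ne_of_ne h1 h2]

theorem norm_gramSchmidt_swap_snd_le :
    ‖gramSchmidt ℝ (v ∘ Equiv.swap i j) j‖ ≤ ‖gramSchmidt ℝ v i‖ := by
  refine norm_gramSchmidt_le _ j ?_
  have hlt : i < j := by simp only [Fin.lt_def]; omega
  have h := gramSchmidt_sub_mem v i
  rw [← swap_image_Iio_of_le v hij le_rfl] at h
  simpa using span_mono (Set.image_mono (Set.Iio_subset_Iio hlt.le)) h

theorem gramSchmidt_swap_fst :
    gramSchmidt ℝ (v ∘ Equiv.swap i j) i = gramSchmidt ℝ v j +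
      (inner ℝ (v j) (gramSchmidt ℝ v i) / ‖gramSchmidt ℝ v i‖ ^ 2) • gramSchmidt ℝ v i := by
  have hlt : i < j := by simp only [Fin.lt_def]; omega
  symm
  refine eq_gramSchmidt _ i ?_ fun k hk => ?_
  · rw [swap_image_Iio_of_le v hij le_rfl, ← span_gramSchmidt_Iio ℝ v i]
    simp only [Function.comp_apply, Equiv.swap_apply_left]
    have hI : Finset.Iio j = insert i (Finset.Iio i) := by
      ext l
      simp only [Finset.mem_Iio, Finset.mem_insert, Fin.lt_def, Fin.ext_iff]
      omega
    have hdef := gramSchmidt_def'' ℝ v j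
    rw [hI, Finset.sum_insert (by simp)] at hdef
    conv in (v j) => rfl
    have : gramSchmidt ℝ v j +
      (inner ℝ (v j) (gramSchmidt ℝ v i) / ‖gramSchmidt ℝ v i‖ ^ 2) • gramSchmidt ℝ v i - v j =
      - ∑ l ∈ Finset.Iio i, (inner ℝ (gramSchmidt ℝ v l) (v j) /
        ((‖gramSchmidt ℝ v l‖ : ℝ) : ℝ) ^ 2) • gramSchmidt ℝ v l := by
      rw [real_inner_comm (gramSchmidt ℝ v i)]
      nth_rewrite 2 [hdef]
      simp only [RCLike.ofReal_real_eq_id, id]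
      abel
    rw [this]
    exact neg_mem (sum_mem fun l hl => smul_mem _ _
      (subset_span ⟨l, Finset.mem_Iio.1 hl, rfl⟩))
  · have h1 : k ≠ i := hk.ne
    have h2 : k ≠ j := (hk.trans hlt).ne
    rw [Function.comp_apply, Equiv.swap_apply_of_ne_of_ne h1 h2, inner_add_right, inner_smul_right,
      inner_gramSchmidt_of_mem_span v i (subset_span ⟨k, hk, rfl⟩),
      inner_gramSchmidt_of_mem_span v j (subset_span ⟨k, hk.trans hlt, rfl⟩)]
    simp

theorem norm_gramSchmidt_swap_fst_sq :
    ‖gramSchmidt ℝ (v ∘ Equiv.swap i j) i‖ ^ 2 = ‖gramSchmidt ℝ v j‖ ^ 2 +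
      (inner ℝ (v j) (gramSchmidt ℝ v i) / ‖gramSchmidt ℝ v i‖ ^ 2) ^ 2 *
        ‖gramSchmidt ℝ v i‖ ^ 2 := by
  have hlt : i < j := by simp only [Fin.lt_def]; omega
  rw [gramSchmidt_swap_fst v hij, @norm_add_sq_real, inner_smul_right,
    gramSchmidt_orthogonal ℝ v hlt.ne', norm_smul, mul_pow, Real.norm_eq_abs, sq_abs]
  ring

end Swap

end GramSchmidt

/-! ### Existence of LLL-reduced bases -/

section LLL

variable {n : ℕ} {L : Submodule ℤ (E n)}

/-- The vectors of a lattice basis. -/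
noncomputable def basisVec (b : Module.Basis (Fin n) ℤ L) : Fin n → E n := fun i => (b i : E n)

/-- The Gram-Schmidt vectors of a lattice basis. -/
noncomputable def gsVec (b : Module.Basis (Fin n) ℤ L) : Fin n → E n :=
  gramSchmidt ℝ (basisVec b)

/-- The size reduction condition. -/
def IsSizeReduced (b : Module.Basis (Fin n) ℤ L) : Prop :=
  ∀ i j : Fin n, j < i → |inner ℝ (basisVec b i) (gsVec b j) / ‖gsVec b j‖ ^ 2| ≤ 1 / 2

theorem span_basisVec (b : Module.Basis (Fin n) ℤ L) : span ℤ (Set.range (basisVec b)) = L := by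
  have h : Set.range (basisVec b) = L.subtype '' Set.range b := by
    rw [← Set.range_comp]; rfl
  rw [h, span_image, b.span_eq, Submodule.map_top, Submodule.range_subtype]

variable [DiscreteTopology L] [IsZLattice ℝ L]

theorem linearIndependent_basisVec (b : Module.Basis (Fin n) ℤ L) :
    LinearIndependent ℝ (basisVec b) := by
  have h : basisVec b = b.ofZLatticeBasis ℝ := funext fun i => by simp [basisVec]
  rw [h]
  exact (b.ofZLatticeBasis ℝ).linearIndependent

theorem gsVec_ne_zero (b : Module.Basis (Fin n) ℤ L) (i : Fin n) : gsVec b i ≠ 0 :=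
  gramSchmidt_ne_zero i (linearIndependent_basisVec b)

theorem exists_basis_of_unitriangular (b : Module.Basis (Fin n) ℤ L) {v' : Fin n → E n}
    (h : ∀ i, v' i - basisVec b i ∈ span ℤ (basisVec b '' Set.Iio i)) :
    ∃ b' : Module.Basis (Fin n) ℤ L, basisVec b' = v' := by
  have hspan : span ℤ (Set.range v') = L := by
    rw [span_range_of_unitriangular h, span_basisVec]
  have hmem : ∀ i, v' i ∈ L := fun i => hspan.le (subset_span ⟨i, rfl⟩)
  have hspanR : ⊤ ≤ span ℝ (Set.range v') := by
    rw [span_range_of_unitriangular (R := ℝ) (fun i => span_int_le_real _ (h i))]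
    rw [(linearIndependent_basisVec b).span_eq_top_of_card_eq_finrank' (by simp)]
  have hli : LinearIndependent ℝ v' :=
    linearIndependent_of_top_le_span_of_card_eq_finrank hspanR (by simp)
  have hliZ : LinearIndependent ℤ v' := hli.restrict_scalars' ℤ
  let w : Fin n → L := fun i => ⟨v' i, hmem i⟩
  have hw : LinearIndependent ℤ w := LinearIndependent.of_comp L.subtype hliZ
  have hwspan : ⊤ ≤ span ℤ (Set.range w) := by
    have h1 : (span ℤ (Set.range w)).map L.subtype = (⊤ : Submodule ℤ L).map L.subtype := by
      rw [← span_image, ← Set.range_comp, Submodule.map_top, Submodule.range_subtype]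
      exact hspan
    exact (Submodule.map_injective_of_injective L.subtype_injective h1).ge
  refine ⟨Module.Basis.mk hw hwspan, ?_⟩
  ext1 i
  simp [basisVec, w]

theorem exists_sizeReduced_basis (b : Module.Basis (Fin n) ℤ L) :
    ∃ b' : Module.Basis (Fin n) ℤ L, gsVec b' = gsVec b ∧ IsSizeReduced b' := by
  choose hv' hred using fun i : Fin n =>
    nearestPlane_spec (basisVec b) (gsVec_ne_zero b) i i.2.le (basisVec b i)
  obtain ⟨b', hb'⟩ := exists_basis_of_unitriangular b hv'
  have hg : gsVec b' = gsVec b := by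
    rw [gsVec, hb']; exact gramSchmidt_of_unitriangular hv'
  refine ⟨b', hg, fun i j hij => ?_⟩
  rw [hg, hb']
  exact hred i j hij

omit [DiscreteTopology L] [IsZLattice ℝ L] in
theorem norm_le_of_sizeReduced {b : Module.Basis (Fin n) ℤ L} (hb : IsSizeReduced b) {M : ℝ}
    (hM : ∀ i, ‖gsVec b i‖ ≤ M) (i : Fin n) : ‖basisVec b i‖ ≤ M + n * M := by
  have hM0 : 0 ≤ M := (norm_nonneg _).trans (hM i)
  have h := gramSchmidt_def'' ℝ (basisVec b) i
  rw [h]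
  refine (norm_add_le _ _).trans (add_le_add (hM i) ((norm_sum_le _ _).trans ?_))
  calc _ ≤ ∑ _j ∈ Finset.Iio i, M := by
        refine Finset.sum_le_sum fun j hj => ?_
        rw [norm_smul, real_inner_comm]
        have h1 := hb i j (Finset.mem_Iio.1 hj)
        have h2 := hM j
        simp only [RCLike.ofReal_real_eq_id, id]
        change |inner ℝ (basisVec b i) (gsVec b j) / ‖gsVec b j‖ ^ 2| * ‖gsVec b j‖ ≤ M
        nlinarith [norm_nonneg (gsVec b j), abs_nonneg (inner ℝ (basisVec b i) (gsVec b j) / ‖gsVec b j‖ ^ 2)]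
    _ ≤ _ := by
      rw [Finset.sum_const, nsmul_eq_mul]
      gcongr
      simp [Fin.card_Iio, i.2.le]

omit [IsZLattice ℝ L] in
theorem finite_norm_le (r : ℝ) : {y : L | ‖(y : E n)‖ ≤ r}.Finite := by
  have h := (summable_rho L one_ne_zero).tendsto_cofinite_zero.eventually
    (gt_mem_nhds (Real.exp_pos (-Real.pi * r ^ 2)))
  refine (Filter.eventually_cofinite.1 h).subset fun y hy => ?_
  have hy : ‖(y : E n)‖ ≤ r := hy
  simp only [rho, Set.mem_ofPred_eq, not_lt]
  apply Real.exp_le_exp.2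
  have : ‖(y : E n)‖ ^ 2 ≤ r ^ 2 := pow_le_pow_left₀ (norm_nonneg _) hy 2
  have := Real.pi_pos
  norm_num
  nlinarith

omit [IsZLattice ℝ L] in
theorem finite_sizeReduced_bases (M : ℝ) :
    {b : Module.Basis (Fin n) ℤ L | IsSizeReduced b ∧ ∀ i, ‖gsVec b i‖ ≤ M}.Finite := by
  have hfin : (Set.univ.pi fun _ : Fin n => {y : L | ‖(y : E n)‖ ≤ M + n * M}).Finite :=
    Set.Finite.pi fun _ => finite_norm_le _
  refine Set.Finite.of_finite_image (f := fun b i => b i) (hfin.subset ?_) ?_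
  · rintro _ ⟨b, ⟨hb, hM⟩, rfl⟩ i -
    exact norm_le_of_sizeReduced hb hM i
  · intro b _ b' _ h
    exact Module.Basis.eq_of_apply_eq fun i => congrFun h i

variable (L) in
theorem exists_isLLLReduced : ∃ b : Module.Basis (Fin n) ℤ L, IsLLLReduced b := by
  obtain ⟨b₀, -, hb₀⟩ := exists_sizeReduced_basis (latticeBasis L)
  obtain ⟨M, hM⟩ : ∃ M, ∀ i, ‖gsVec b₀ i‖ ≤ M := by
    obtain ⟨M, hM⟩ := (Set.finite_range fun i => ‖gsVec b₀ i‖).bddAbove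
    exact ⟨M, fun i => hM ⟨i, rfl⟩⟩
  obtain ⟨b, ⟨hb, hbM⟩, hmin⟩ := Set.exists_min_image _
    (fun b : Module.Basis (Fin n) ℤ L => toLex fun i => ‖gsVec b i‖)
    (finite_sizeReduced_bases (L := L) M) ⟨b₀, hb₀, hM⟩
  refine ⟨b, hb, fun i j hij => ?_⟩
  change 3 / 4 * ‖gsVec b i‖ ^ 2 ≤ ‖gsVec b j‖ ^ 2 +
    (inner ℝ (basisVec b j) (gsVec b i) / ‖gsVec b i‖ ^ 2) ^ 2 * ‖gsVec b i‖ ^ 2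
  by_contra! hlt
  rw [gsVec, ← norm_gramSchmidt_swap_fst_sq (basisVec b) hij] at hlt
  obtain ⟨b', hg, hb'⟩ := exists_sizeReduced_basis (b.reindex (Equiv.swap i j))
  have hg' : gsVec b' = gramSchmidt ℝ (basisVec b ∘ Equiv.swap i j) := by
    rw [hg, gsVec]
    congr 1
    ext1 k
    simp [basisVec]
  have hfst : ‖gsVec b' i‖ < ‖gsVec b i‖ := by
    rw [hg']
    refine lt_of_pow_lt_pow_left₀ 2 (norm_nonneg _) (hlt.trans_le ?_)
    have := sq_nonneg ‖gsVec b i‖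
    change 3 / 4 * ‖gsVec b i‖ ^ 2 ≤ _
    linarith
  have hb'M : ∀ k, ‖gsVec b' k‖ ≤ M := by
    intro k
    rcases lt_trichotomy k i with hk | rfl | hk
    · rw [hg', gramSchmidt_swap_of_lt _ hij hk]; exact hbM k
    · exact hfst.le.trans (hbM k)
    · rcases eq_or_ne k j with rfl | hkj
      · rw [hg']; exact (norm_gramSchmidt_swap_snd_le _ hij).trans (hbM i)
      · have : j < k := by
          simp only [Fin.lt_def, ne_eq, Fin.ext_iff] at *
          omega
        rw [hg', gramSchmidt_swap_of_gt _ hij this]; exact hbM k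
  refine (hmin b' ⟨hb', hb'M⟩).not_gt ⟨i, fun k hk => ?_, hfst⟩
  change ‖gsVec b' k‖ = ‖gsVec b k‖
  rw [hg', gramSchmidt_swap_of_lt _ hij hk, gsVec]

/-! ### Babai's algorithm on an LLL-reduced basis -/

omit [DiscreteTopology L] [IsZLattice ℝ L] in
theorem norm_gsVec_sq_le_two_mul {b : Module.Basis (Fin n) ℤ L} (hb : IsLLLReduced b) {i j : Fin n}
    (hij : (j : ℕ) = i + 1) : ‖gsVec b i‖ ^ 2 ≤ 2 * ‖gsVec b j‖ ^ 2 := by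
  have h1 : 3 / 4 * ‖gsVec b i‖ ^ 2 ≤ ‖gsVec b j‖ ^ 2 +
    (inner ℝ (basisVec b j) (gsVec b i) / ‖gsVec b i‖ ^ 2) ^ 2 * ‖gsVec b i‖ ^ 2 := hb.2 i j hij
  have h2 : |inner ℝ (basisVec b j) (gsVec b i) / ‖gsVec b i‖ ^ 2| ≤ 1 / 2 :=
    hb.1 j i (by simp only [Fin.lt_def]; omega)
  have h3 := sq_le_sq' (by linarith [(abs_le.1 h2).1]) (abs_le.1 h2).2
  nlinarith [sq_nonneg ‖gsVec b i‖]

theorem norm_gsVec_last_sq_le (b : Module.Basis (Fin n) ℤ L) {l : Fin n} (hl : (l : ℕ) + 1 = n) :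
    ‖gsVec b l‖ ^ 2 ≤ 2 * Real.pi * eta L ^ 2 := by
  have hg := gsVec_ne_zero b l
  have hpos : 0 < ‖gsVec b l‖ ^ 2 := pow_pos (norm_pos_iff.2 hg) 2
  have hin : ∀ i, ∃ z : ℤ, inner ℝ ((‖gsVec b l‖ ^ 2)⁻¹ • gsVec b l) (basisVec b i) = (z : ℝ) := by
    intro i
    rw [inner_smul_left, conj_trivial]
    rcases eq_or_ne i l with rfl | hi
    · refine ⟨1, ?_⟩
      rw [real_inner_comm, gsVec, inner_self_gramSchmidt, Int.cast_one]
      exact inv_mul_cancel₀ hpos.ne'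
    · refine ⟨0, ?_⟩
      have : i < l := by
        simp only [Fin.lt_def, ne_eq, Fin.ext_iff] at *
        omega
      rw [gsVec, gramSchmidt_inv_triangular ℝ _ this, mul_zero, Int.cast_zero]
  have hdual : (‖gsVec b l‖ ^ 2)⁻¹ • gsVec b l ∈ dualLattice L := by
    rw [mem_dualLattice]
    intro y hy
    rw [← span_basisVec b] at hy
    induction hy using span_induction with
    | mem y hy => obtain ⟨i, rfl⟩ := hy; exact hin i
    | zero => exact ⟨0, by simp⟩
    | add y z _ _ hy hz =>
      obtain ⟨p, hp⟩ := hy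
      obtain ⟨q, hq⟩ := hz
      exact ⟨p + q, by rw [inner_add_right, hp, hq, Int.cast_add]⟩
    | smul a y _ hy =>
      obtain ⟨p, hp⟩ := hy
      exact ⟨a * p, by rw [← Int.cast_smul_eq_zsmul ℝ, inner_smul_right, hp, Int.cast_mul]⟩
  have h := half_le_of_mem_dual L (by omega) hdual (smul_ne_zero (inv_ne_zero hpos.ne') hg)
  have hnorm : ‖(‖gsVec b l‖ ^ 2)⁻¹ • gsVec b l‖ ^ 2 = (‖gsVec b l‖ ^ 2)⁻¹ := by
    rw [norm_smul, mul_pow, norm_inv, Real.norm_of_nonneg hpos.le]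
    field_simp
  rw [hnorm, mul_right_comm, ← div_eq_mul_inv, le_div_iff₀ hpos] at h
  linarith

theorem norm_gsVec_sq_le {b : Module.Basis (Fin n) ℤ L} (hb : IsLLLReduced b) (i : Fin n) :
    ‖gsVec b i‖ ^ 2 ≤ 2 ^ n * (Real.pi * eta L ^ 2) := by
  have hpos : 0 ≤ 2 * Real.pi * eta L ^ 2 := by positivity
  have key : ∀ k (i : Fin n), (i : ℕ) + k + 1 = n →
      ‖gsVec b i‖ ^ 2 ≤ 2 ^ k * (2 * Real.pi * eta L ^ 2) := by
    intro k
    induction k with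
    | zero =>
      intro i hi
      simpa using norm_gsVec_last_sq_le b hi
    | succ k ih =>
      intro i hi
      have h1 := norm_gsVec_sq_le_two_mul hb (i := i) (j := ⟨i + 1, by omega⟩) rfl
      have h2 := ih ⟨i + 1, by omega⟩ (by simp only; omega)
      calc ‖gsVec b i‖ ^ 2 ≤ 2 * (2 ^ k * (2 * Real.pi * eta L ^ 2)) := h1.trans (by gcongr)
        _ = _ := by ring
  have hi := i.2
  refine (key (n - 1 - i) i (by omega)).trans ?_
  calc (2 : ℝ) ^ (n - 1 - (i : ℕ)) * (2 * Real.pi * eta L ^ 2) ≤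
        2 ^ (n - 1) * (2 * Real.pi * eta L ^ 2) := by
        refine mul_le_mul_of_nonneg_right ?_ hpos
        exact pow_le_pow_right₀ (by norm_num) (by omega)
    _ = 2 ^ n * (Real.pi * eta L ^ 2) := by
      obtain ⟨k, rfl⟩ : ∃ k, n = k + 1 := ⟨n - 1, by omega⟩
      rw [Nat.add_sub_cancel, pow_succ]
      ring

theorem norm_sq_le_of_coeff_le (b : Module.Basis (Fin n) ℤ L) {t : E n}
    (ht : ∀ j, |inner ℝ t (gsVec b j) / ‖gsVec b j‖ ^ 2| ≤ 1 / 2) :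
    ‖t‖ ^ 2 ≤ ∑ j, ‖gsVec b j‖ ^ 2 / 4 := by
  have hli := linearIndependent_basisVec b
  let o := gramSchmidtOrthonormalBasis (𝕜 := ℝ) (by simp) (basisVec b)
  rw [← o.sum_sq_norm_inner_left t]
  refine Finset.sum_le_sum fun j _ => ?_
  have hpos : 0 < ‖gsVec b j‖ := norm_pos_iff.2 (gsVec_ne_zero b j)
  have ho : o j = ‖gsVec b j‖⁻¹ • gsVec b j :=
    gramSchmidtOrthonormalBasis_apply _ (by
      rw [← norm_ne_zero_iff, gramSchmidtNormed_unit_length j hli]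
      exact one_ne_zero)
  have h := sq_le_sq' (by linarith [(abs_le.1 (ht j)).1]) (abs_le.1 (ht j)).2
  have heq : ‖inner ℝ t (o j)‖ ^ 2 =
      (inner ℝ t (gsVec b j) / ‖gsVec b j‖ ^ 2) ^ 2 * ‖gsVec b j‖ ^ 2 := by
    rw [ho, inner_smul_right, Real.norm_eq_abs, sq_abs]
    field_simp
  rw [heq]
  nlinarith [sq_nonneg ‖gsVec b j‖]

theorem norm_babai_le {b : Module.Basis (Fin n) ℤ L} (hb : IsLLLReduced b) (hn : 0 < n) (t : E n) :
    ‖(babai (List.ofFn (basisVec b)) t).val‖ ≤ 2 ^ n * eta L := by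
  have hs := eta_pos L hn
  have h := norm_sq_le_of_coeff_le b (babai_spec (basisVec b) (gsVec_ne_zero b) t).2
  refine (abs_le_of_sq_le_sq' ?_ (by positivity)).2
  calc _ ≤ ∑ j, ‖gsVec b j‖ ^ 2 / 4 := h
    _ ≤ ∑ _j : Fin n, 2 ^ n * eta L ^ 2 := by
      refine Finset.sum_le_sum fun j _ => ?_
      have h1 := norm_gsVec_sq_le hb j
      have h2 : 2 ^ n * (Real.pi * eta L ^ 2) ≤ 2 ^ n * (4 * eta L ^ 2) := by
        gcongr; exact Real.pi_le_four
      linarith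
    _ = n * (2 ^ n * eta L ^ 2) := by simp
    _ ≤ 2 ^ n * (2 ^ n * eta L ^ 2) := by
      gcongr
      exact_mod_cast n.lt_two_pow_self.le
    _ = _ := by ring

/-! ### The query algorithm -/

theorem isOutput_query {N : ℕ} {b : Module.Basis (Fin n) ℤ L} (hb : IsLLLReduced b) (hn : 0 < n)
    (y : Fin N → L) (t : E n) :
    IsOutput L (fun i => (y i : E n)) t (queryLattice b y t).val := by
  obtain ⟨j, τ, h0, hstep, hend, hval⟩ := reduce_trace (fun i => (y i : E n)) (100 * n ^ 3)
    (babai (List.ofFn (basisVec b)) t).val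
  refine ⟨j, τ, ?_, ?_, hstep, hend, ?_⟩
  · rw [h0]
    exact (span_basisVec b).le (babai_spec (basisVec b) (gsVec_ne_zero b) t).1
  · rw [h0]; exact norm_babai_le hb hn t
  · rw [← hval, queryLattice, query, Timed.val_bind, Timed.val_bind, subMul_val, one_smul]
    rfl

end LLL

end GDD

namespace GDD

/-! ### The number of samples and the running time -/

section Bounds

variable {n : ℕ} {α : ℝ}

theorem one_le_nAlpha (hn : 40 ≤ n) : 1 ≤ nAlpha n α := by
  have hn' : (40 : ℝ) ≤ n := by exact_mod_cast hn
  exact one_le_mul_of_one_le_of_one_le (by nlinarith) (Real.one_le_exp (by positivity))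

theorem sampleCount_le_two_mul (hn : 40 ≤ n) : (sampleCount n α : ℝ) ≤ 2 * nAlpha n α := by
  have h1 := one_le_nAlpha (α := α) hn
  have h2 := Nat.ceil_lt_add_one (zero_le_one.trans h1)
  rw [sampleCount]
  linarith

theorem sampleCount_le (hn : 40 ≤ n) (h2 : α ≤ 1 / 2) {C : ℕ} (hC : 50 ≤ C) :
    (sampleCount n α : ℝ) ≤ (2 : ℝ) ^ ((C : ℝ) * ((n : ℝ) ^ (1 - 2 * α) + Real.logb 2 n)) := by
  have hn' : (40 : ℝ) ≤ n := by exact_mod_cast hn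
  have hn0 : (0 : ℝ) < n := by linarith
  have hC' : (50 : ℝ) ≤ C := by exact_mod_cast hC
  have hX1 := one_le_rpow_half_sub hn h2
  have hXsq : (n : ℝ) ^ (1 - 2 * α) = ((n : ℝ) ^ (1 / 2 - α)) ^ 2 := by
    rw [← Real.rpow_natCast, ← Real.rpow_mul hn0.le]
    congr 1
    push_cast
    ring
  refine (sampleCount_le_two_mul hn).trans ?_
  rw [hXsq, nAlpha]
  set X := (n : ℝ) ^ (1 / 2 - α)
  have hlog : 0 ≤ Real.logb 2 n := Real.logb_nonneg (by norm_num) (by linarith)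
  have hexp : Real.exp ((X + 4) ^ 2) ≤ (2 : ℝ) ^ (50 * X ^ 2) := by
    rw [Real.rpow_def_of_pos (by norm_num)]
    apply Real.exp_le_exp.2
    have := Real.log_two_gt_d9
    nlinarith [sq_nonneg X]
  have hpow : (n : ℝ) ^ 3 = (2 : ℝ) ^ (3 * Real.logb 2 n) := by
    rw [mul_comm, Real.rpow_mul (by norm_num), Real.rpow_logb (by norm_num) (by norm_num) hn0]
    norm_cast
  calc 2 * ((n : ℝ) ^ 2 * Real.exp ((X + 4) ^ 2)) = 2 * (n : ℝ) ^ 2 * Real.exp ((X + 4) ^ 2) := by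
        ring
    _ ≤ (n : ℝ) ^ 3 * (2 : ℝ) ^ (50 * X ^ 2) := by
        gcongr
        nlinarith [sq_nonneg (n : ℝ)]
    _ = (2 : ℝ) ^ (3 * Real.logb 2 n + 50 * X ^ 2) := by
        rw [hpow, Real.rpow_add (by norm_num)]
    _ ≤ _ := by
        apply Real.rpow_le_rpow_of_exponent_le (by norm_num)
        nlinarith [sq_nonneg X]

theorem queryLattice_steps_le (hn : 40 ≤ n) {C : ℕ} (hC : 10000 ≤ C) {L : Submodule ℤ (E n)}
    (b : Module.Basis (Fin n) ℤ L) (y : Fin (sampleCount n α) → L) (t : E n) :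
    ((queryLattice b y t).steps : ℝ) ≤ (C : ℝ) * (n : ℝ) ^ C * nAlpha n α := by
  have hn' : (40 : ℝ) ≤ n := by exact_mod_cast hn
  have hN2 := sampleCount_le_two_mul (α := α) hn
  have h1 := query_steps_le (List.ofFn fun i => (b i : E n)) (List.ofFn fun i => (y i : E n)) t
  simp only [List.length_ofFn] at h1
  have hA := one_le_nAlpha (α := α) hn
  set A := nAlpha n α
  have h2 : ((queryLattice b y t).steps : ℝ) ≤ n * (1 + n * (16 * n + 3)) + n * (16 * n + 4) +
      100 * n ^ 3 * (1 + (sampleCount n α : ℝ) * (26 * n + 9)) + 6 * n := by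
    exact_mod_cast h1
  have p1 : (n : ℝ) ≤ n ^ 4 := le_self_pow₀ (by linarith) (by norm_num)
  have p2 : (n : ℝ) ^ 2 ≤ n ^ 4 := pow_le_pow_right₀ (by linarith) (by norm_num)
  have p3 : (n : ℝ) ^ 3 ≤ n ^ 4 := pow_le_pow_right₀ (by linarith) (by norm_num)
  have h3 : ((queryLattice b y t).steps : ℝ) ≤ 10000 * (n : ℝ) ^ 4 * A := by
    have q1 : 100 * (n : ℝ) ^ 3 * (1 + (sampleCount n α : ℝ) * (26 * n + 9)) ≤
        100 * (n : ℝ) ^ 3 * (1 + 2 * A * (26 * n + 9)) := by gcongr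
    have q2 : (n : ℝ) ^ 4 ≤ n ^ 4 * A := le_mul_of_one_le_right (by positivity) hA
    have q3 : (n : ℝ) ^ 3 * A ≤ n ^ 4 * A := by gcongr
    nlinarith
  refine h3.trans ?_
  have hC' : (10000 : ℝ) ≤ C := by exact_mod_cast hC
  have hpow : (n : ℝ) ^ 4 ≤ (n : ℝ) ^ C := pow_le_pow_right₀ (by linarith) (by omega)
  gcongr

end Bounds

end GDD

theorem theorem3p1 :
    ∃ C : ℕ, ∀ (n : ℕ) (α : ℝ), 40 ≤ n → 2 / Real.logb 2 n ≤ α → α ≤ 1 / 2 →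
      (GDD.sampleCount n α : ℝ) ≤
          (2 : ℝ) ^ ((C : ℝ) * ((n : ℝ) ^ (1 - 2 * α) + Real.logb 2 n)) ∧
      ∀ (L : Submodule ℤ (GDD.E n)) [DiscreteTopology L] [IsZLattice ℝ L],
        (∃ b : Module.Basis (Fin n) ℤ L, GDD.IsLLLReduced b) ∧
        (∀ b : Module.Basis (Fin n) ℤ L, GDD.IsLLLReduced b →
          ∀ (y : Fin (GDD.sampleCount n α) → L) (t : GDD.E n),
            GDD.IsOutput L (fun i => (y i : GDD.E n)) t (GDD.queryLattice b y t).val ∧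
            ((GDD.queryLattice b y t).steps : ℝ) ≤ (C : ℝ) * (n : ℝ) ^ C * GDD.nAlpha n α) ∧
        1 - (2 : ℝ≥0∞)⁻¹ ^ n ≤
          (Measure.pi fun _ : Fin (GDD.sampleCount n α) => GDD.discreteGaussian L (GDD.eta L))
            {y | (∀ t z : GDD.E n, GDD.IsOutput L (fun i => (y i : GDD.E n)) t z →
                    z ∈ L ∧ ‖z - t‖ ≤ (n : ℝ) ^ (1 / 2 + α) * GDD.eta L) ∧
                  ∀ b : Module.Basis (Fin n) ℤ L, GDD.IsLLLReduced b →
                    GDD.SolvesGDD L ((n : ℝ) ^ (1 / 2 + α) * GDD.eta L)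
                      fun t => (GDD.queryLattice b y t).val} := by
  obtain ⟨C, hC⟩ : ∃ C : ℕ, 10000 ≤ C := ⟨10000, le_rfl⟩
  refine ⟨C, fun n α hn h1 h2 => ⟨GDD.sampleCount_le hn h2 (by omega), fun L _ _ =>
    ⟨GDD.exists_isLLLReduced L, fun b hb y t => ⟨GDD.isOutput_query hb (by omega) y t,
      GDD.queryLattice_steps_le hn hC b y t⟩, ?_⟩⟩⟩
  refine (GDD.measure_isOutput_close_ge L hn h1 h2).trans (measure_mono fun y hy => ⟨hy, ?_⟩)
  exact fun b hb t => hy t _ (GDD.isOutput_query hb (by omega) y t)
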